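/- Let $d\ge 1$. An integral $d\times d$ matrix is expansive if all its complex eigenvalues have modulus $>1$. On $L^2(\mathbb R^d)$ (complex-valued functions, Lebesgue measure) put $(T_{v}f)(t)=f(t-v)$ for $v\in\mathbb R^d$, $(U_Mf)(t)=\sqrt{|\det M|}\,f(Mt)$ for an invertible real matrix $M$, and $D_M=U_M$ when $|\det M|=2$. For an integral expansive matrix $B$ with $|\det B|=2$, a function $\psi\in L^2(\mathbb R^d)$ is a Parseval frame wavelet associated with $B$ if $\sum_{n\in\mathbb Z,\ \ell\in\mathbb Z^d}|\langle f,D_B^nT_\ell\psi\rangle|^2=\|f\|^2$ for all $f\in L^2(\mathbb R^d)$. For $f\in L^2(\mathbb R^d)$ let $V_B^{(0)}(f)=\overline{\operatorname{span}}\{T_\ell f:\ell\in\mathbb Z^d\}$ and $V_B^{(n)}(f)=D_B^nV_B^{(0)}(f)$, $n\in\mathbb Z$. The Fourier transform is the unitary extension to $L^2(\mathbb R^d)$ of $(\mathcal Ff)(s)=(2\pi)^{-d/2}\int_{\mathbb R^d}e^{-is\cdot t}f(t)\,dt$. **Theorem.** Let $A_0$ be a $d\times d$ expansive integral matrix with $\det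 A_0=\pm2$. Then there are an integral matrix $A$, an integral matrix $S$ with $\det S=\pm1$ and $A_0=S^{-1}AS$, and vectors $\ell_A,q_A\in\mathbb Z^d$ such that * (P1) $A\mathbb Z^d=A^{\tau}\mathbb Z^d$, where $A^\tau$ is the transpose of $A$; * (P2) $\mathbb Z^d$ is the disjoint union of $\ell_A+A\mathbb Z^d$ and $A\mathbb Z^d$; * (P3) $q_A\cdot x$ is even for $x\in A\mathbb Z^d$ and odd for $x\in \ell_A+A\mathbb Z^d$; * (P4) for all $m\in A\mathbb Z^d$ and $n\in\mathbb Z^d$, $\mathbb Z^d$ is the disjoint union of $n-A\mathbb Z^d$ and $\ell_A-m-n+A\mathbb Z^d$; * (P5) for all $m\in \ell_A+A\mathbb Z^d$ and $n\in\mathbb Z^d$, $n-A\mathbb Z^d=\ell_A-m-n+A\mathbb Z^d$. Moreover, for all such $A,S,\ell_A,q_A$, every $N_0\in\mathbb N$, and every complex family $(h_n)_{n\in\mathbb Z^d}$ that vanishes outside $\Lambda_0=\mathbb Z^d\cap[-N_0,N_0]^d$ and solves Lawton's equations $$\sum_{n\in\mathbb Z^d}h_n\overline{h_{n+k}}=\delta_{0k}\quad(k\in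 A\mathbb Z^d),\qquad \sum_{n\in\mathbb Z^d}h_n=\sqrt2,$$ the following holds. Let $m_0(t)=\frac1{\sqrt2}\sum_{n}h_ne^{-in\cdot t}$. The product $g(\xi)=(2\pi)^{-d/2}\prod_{j=1}^\infty m_0((A^\tau)^{-j}\xi)$ converges (unconditionally) for every $\xi\in\mathbb R^d$, and $g\in L^2(\mathbb R^d)$. Put $$\varphi_A=\mathcal F^{-1}g,\quad \psi_A=\sum_{n\in\mathbb Z^d}(-1)^{q_A\cdot n}\,\overline{h_{\ell_A-n}}\,D_AT_n\varphi_A,\quad \varphi_{A_0}(t)=\varphi_A(St),\quad \psi_{A_0}(t)=\psi_A(St).$$ Then: 1. $\psi_{A_0}$ is a Parseval frame wavelet associated with $A_0$. 2. $\displaystyle\varphi_{A_0}=\sum_{n\in\Lambda_0}h_n\,D_{A_0}T_{S^{-1}n}\varphi_{A_0}$ and $\displaystyle\psi_{A_0}=\sum_{n:\ \ell_A-n\in\Lambda_0}(-1)^{q_A\cdot n}\,\overline{h_{\ell_A-n}}\,D_{A_0}T_{S^{-1}n}\varphi_{A_0}$. 3. $V^{(n)}_{A_0}(\varphi_{A_0})\subset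 V^{(n+1)}_{A_0}(\varphi_{A_0})$ for all $n\in\mathbb Z$. 4. $\overline{\bigcup_{n\in\mathbb Z}V^{(n)}_{A_0}(\varphi_{A_0})}=L^2(\mathbb R^d)$. -/

import Mathlib

open MeasureTheory

namespace ParsevalWavelet

noncomputable section

/-- The Euclidean space `ℝ^d`. -/
abbrev Euc (d : ℕ) : Type := EuclideanSpace ℝ (Fin d)

/-- The Hilbert space `L²(ℝ^d)` of complex-valued functions, for Lebesgue measure. -/
abbrev L2 (d : ℕ) : Type := Lp ℂ 2 (volume : Measure (Euc d))

variable {d : ℕ}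

/-- A real matrix acting on `ℝ^d`. -/
def act (M : Matrix (Fin d) (Fin d) ℝ) (t : Euc d) : Euc d :=
  WithLp.toLp 2 (M.mulVec t.ofLp)

/-- An integral vector, seen in `ℝ^d`. -/
def intVec (n : Fin d → ℤ) : Euc d := WithLp.toLp 2 (fun i => (n i : ℝ))

/-- An integral matrix, seen as a real matrix. -/
def toReal (A : Matrix (Fin d) (Fin d) ℤ) : Matrix (Fin d) (Fin d) ℝ :=
  A.map (fun a : ℤ => (a : ℝ))

/-! ### Translation and dilation operators -/

/-- The translation operator `(T_v f)(t) = f (t - v)` on `L²(ℝ^d)`. -/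
def translation (v : Euc d) : L2 d →ₗᵢ[ℂ] L2 d :=
  Lp.compMeasurePreservingₗᵢ ℂ (fun t : Euc d => t - v) (measurePreserving_sub_right volume v)

theorem coeFn_translation (v : Euc d) (f : L2 d) :
    (translation v f : Euc d → ℂ) =ᵐ[volume] fun t => f (t - v) :=
  Lp.coeFn_compMeasurePreserving f (measurePreserving_sub_right volume v)

theorem act_eq_toEuclideanLin (M : Matrix (Fin d) (Fin d) ℝ) :
    act M = Matrix.toEuclideanLin M := rfl

theorem det_toEuclideanLin (M : Matrix (Fin d) (Fin d) ℝ) :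
    LinearMap.det (Matrix.toEuclideanLin M) = M.det := by
  have h : Matrix.toEuclideanLin M
      = Matrix.toLin (EuclideanSpace.basisFun (Fin d) ℝ).toBasis
          (EuclideanSpace.basisFun (Fin d) ℝ).toBasis M := by
    rw [Matrix.toEuclideanLin_eq_toLin_orthonormal]
  rw [h, LinearMap.det_toLin]

theorem measurable_act (M : Matrix (Fin d) (Fin d) ℝ) : Measurable (act M) := by
  rw [act_eq_toEuclideanLin]
  exact (LinearMap.continuous_of_finiteDimensional _).measurable

theorem act_mul (M N : Matrix (Fin d) (Fin d) ℝ) (t : Euc d) :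
    act M (act N t) = act (M * N) t := by
  simp [act, Matrix.mulVec_mulVec]

theorem act_one (t : Euc d) : act 1 t = t := by
  simp [act]

theorem map_act_volume {M : Matrix (Fin d) (Fin d) ℝ} (hM : M.det ≠ 0) :
    Measure.map (act M) volume = ENNReal.ofReal |M.det⁻¹| • (volume : Measure (Euc d)) := by
  rw [act_eq_toEuclideanLin]
  have h : LinearMap.det (Matrix.toEuclideanLin M) ≠ 0 := by rwa [det_toEuclideanLin]
  rw [Measure.map_linearMap_addHaar_eq_smul_addHaar volume h, det_toEuclideanLin]

theorem quasiMeasurePreserving_act {M : Matrix (Fin d) (Fin d) ℝ} (hM : M.det ≠ 0) :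
    Measure.QuasiMeasurePreserving (act M) (volume : Measure (Euc d)) volume := by
  refine ⟨measurable_act M, ?_⟩
  rw [map_act_volume hM]
  exact Measure.smul_absolutelyContinuous

/-- The function `t ↦ √|det M| f (M t)`. -/
def dilateFun (M : Matrix (Fin d) (Fin d) ℝ) (f : Euc d → ℂ) : Euc d → ℂ :=
  fun t => (Real.sqrt |M.det| : ℂ) * f (act M t)

theorem dilateFun_congr {M : Matrix (Fin d) (Fin d) ℝ} (hM : M.det ≠ 0) {f g : Euc d → ℂ}
    (h : f =ᵐ[volume] g) : dilateFun M f =ᵐ[volume] dilateFun M g := by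
  filter_upwards [(quasiMeasurePreserving_act hM).ae_eq_comp h] with t ht
  simp only [Function.comp_apply] at ht
  simp only [dilateFun, ht]

theorem dilateFun_dilateFun (M N : Matrix (Fin d) (Fin d) ℝ) (f : Euc d → ℂ) :
    dilateFun M (dilateFun N f) = dilateFun (N * M) f := by
  ext t
  simp only [dilateFun, act_mul, Matrix.det_mul, abs_mul, Real.sqrt_mul (abs_nonneg _)]
  push_cast
  ring

theorem dilateFun_one (f : Euc d → ℂ) : dilateFun 1 f = f := by
  ext t
  simp [dilateFun, act_one]

theorem aestronglyMeasurable_dilateFun {M : Matrix (Fin d) (Fin d) ℝ} (hM : M.det ≠ 0)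
    {f : Euc d → ℂ} (hf : AEStronglyMeasurable f volume) :
    AEStronglyMeasurable (dilateFun M f) volume :=
  (hf.comp_quasiMeasurePreserving (quasiMeasurePreserving_act hM)).const_mul _

theorem eLpNorm_dilateFun {M : Matrix (Fin d) (Fin d) ℝ} (hM : M.det ≠ 0) {f : Euc d → ℂ}
    (hf : AEStronglyMeasurable f volume) :
    eLpNorm (dilateFun M f) 2 volume = eLpNorm f 2 volume := by
  have h0 : 0 < |M.det| := abs_pos.mpr hM
  have h1 : dilateFun M f = (Real.sqrt |M.det| : ℂ) • (f ∘ act M) := by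
    ext t; simp [dilateFun]
  have hf' : AEStronglyMeasurable f (Measure.map (act M) volume) := by
    rw [map_act_volume hM]; exact hf.smul_measure _
  rw [h1, eLpNorm_const_smul, ← eLpNorm_map_measure hf' (measurable_act M).aemeasurable,
    map_act_volume hM, eLpNorm_smul_measure_of_ne_top (by norm_num), smul_eq_mul, ← mul_assoc]
  have h2 : ‖(Real.sqrt |M.det| : ℂ)‖ₑ = ENNReal.ofReal (Real.sqrt |M.det|) := by
    rw [← ofReal_norm, Complex.norm_real, Real.norm_of_nonneg (Real.sqrt_nonneg _)]
  have h3 : ENNReal.ofReal |M.det⁻¹| ^ (1 / (2 : ENNReal)).toReal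
      = ENNReal.ofReal (Real.sqrt |M.det|)⁻¹ := by
    rw [ENNReal.ofReal_rpow_of_nonneg (abs_nonneg _) (by positivity), abs_inv]
    congr 1
    rw [← Real.sqrt_inv, Real.sqrt_eq_rpow]
    norm_num
  rw [h2, h3, ← ENNReal.ofReal_mul (Real.sqrt_nonneg _),
    mul_inv_cancel₀ (Real.sqrt_ne_zero'.mpr h0), ENNReal.ofReal_one, one_mul]

theorem memLp_dilateFun {M : Matrix (Fin d) (Fin d) ℝ} (hM : M.det ≠ 0) {f : Euc d → ℂ}
    (hf : MemLp f 2 volume) : MemLp (dilateFun M f) 2 volume :=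
  ⟨aestronglyMeasurable_dilateFun hM hf.1, by rw [eLpNorm_dilateFun hM hf.1]; exact hf.2⟩

/-- The linear isometry `f ↦ √|det M| f (M ·)` of `L²(ℝ^d)`, for an invertible matrix `M`. -/
def dilationIso (M : Matrix (Fin d) (Fin d) ℝ) (hM : M.det ≠ 0) : L2 d →ₗᵢ[ℂ] L2 d where
  toFun f := (memLp_dilateFun hM (Lp.memLp f)).toLp (dilateFun M f)
  map_add' f g := by
    apply Lp.ext
    filter_upwards [(memLp_dilateFun hM (Lp.memLp (f + g))).coeFn_toLp,
      Lp.coeFn_add ((memLp_dilateFun hM (Lp.memLp f)).toLp (dilateFun M f))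
        ((memLp_dilateFun hM (Lp.memLp g)).toLp (dilateFun M g)),
      (memLp_dilateFun hM (Lp.memLp f)).coeFn_toLp,
      (memLp_dilateFun hM (Lp.memLp g)).coeFn_toLp,
      dilateFun_congr hM (Lp.coeFn_add f g)] with t h1 h2 h3 h4 h5
    rw [h1, h2, Pi.add_apply, h3, h4, h5]
    simp [dilateFun, mul_add]
  map_smul' c f := by
    apply Lp.ext
    filter_upwards [(memLp_dilateFun hM (Lp.memLp (c • f))).coeFn_toLp,
      Lp.coeFn_smul c ((memLp_dilateFun hM (Lp.memLp f)).toLp (dilateFun M f)),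
      (memLp_dilateFun hM (Lp.memLp f)).coeFn_toLp,
      dilateFun_congr hM (Lp.coeFn_smul c f)] with t h1 h2 h3 h4
    rw [h1, RingHom.id_apply, h2, Pi.smul_apply, h3, h4]
    simp only [dilateFun, Pi.smul_apply, smul_eq_mul]
    ring
  norm_map' f := by
    change ‖(memLp_dilateFun hM (Lp.memLp f)).toLp (dilateFun M f)‖ = ‖f‖
    rw [Lp.norm_toLp, eLpNorm_dilateFun hM (Lp.memLp f).1, Lp.norm_def]

theorem coeFn_dilationIso {M : Matrix (Fin d) (Fin d) ℝ} (hM : M.det ≠ 0) (f : L2 d) :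
    (dilationIso M hM f : Euc d → ℂ) =ᵐ[volume] dilateFun M f :=
  (memLp_dilateFun hM (Lp.memLp f)).coeFn_toLp

theorem dilationIso_surjective {M : Matrix (Fin d) (Fin d) ℝ} (hM : M.det ≠ 0) :
    Function.Surjective (dilationIso M hM) := by
  intro f
  have hu : IsUnit M.det := isUnit_iff_ne_zero.mpr hM
  have hM' : (M⁻¹).det ≠ 0 := by
    rw [Matrix.det_nonsing_inv]; exact (hu.ringInverse).ne_zero
  refine ⟨dilationIso M⁻¹ hM' f, ?_⟩
  apply Lp.ext
  refine (coeFn_dilationIso hM _).trans ?_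
  refine (dilateFun_congr hM (coeFn_dilationIso hM' f)).trans ?_
  rw [dilateFun_dilateFun, Matrix.nonsing_inv_mul _ hu, dilateFun_one]

open Classical in
/-- The unitary operator `(U_M f)(t) = √|det M| f (M t)` on `L²(ℝ^d)`, for a real matrix `M` with
`det M ≠ 0` (for a singular matrix, which never occurs below, it is the identity by convention).
For `|det M| = 2` it is the dilation operator `D_M`. -/
def dilation (M : Matrix (Fin d) (Fin d) ℝ) : L2 d ≃ₗᵢ[ℂ] L2 d :=
  if hM : M.det ≠ 0 then
    LinearIsometryEquiv.ofSurjective (dilationIso M hM) (dilationIso_surjective hM)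
  else LinearIsometryEquiv.refl ℂ (L2 d)

theorem coeFn_dilation {M : Matrix (Fin d) (Fin d) ℝ} (hM : M.det ≠ 0) (f : L2 d) :
    (dilation M f : Euc d → ℂ) =ᵐ[volume]
      fun t => (Real.sqrt |M.det| : ℂ) * f (act M t) := by
  rw [dilation, dif_pos hM]
  exact coeFn_dilationIso hM f

/-! ### The Fourier transform -/

/-- The unitary Fourier transform on `L²(ℝ^d)` in the normalization
`(ℱ f)(s) = (2π)^(-d/2) ∫ exp(-i s·t) f(t) dt`. It is obtained from Mathlib's Fourier–Plancherel
transform `f ↦ ∫ exp(-2πi s·t) f(t) dt` by the unitary rescaling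
`F ↦ (2π)^(-d/2) F(s / 2π)`, which is `U_M` for `M = (2π)⁻¹ I`. -/
def fourierL2 (d : ℕ) : L2 d ≃ₗᵢ[ℂ] L2 d :=
  (Lp.fourierTransformₗᵢ (Euc d) ℂ).trans
    (dilation ((2 * Real.pi)⁻¹ • (1 : Matrix (Fin d) (Fin d) ℝ)))

theorem fourierL2_toLp (f : SchwartzMap (Euc d) ℂ) :
    fourierL2 d (f.toLp 2) = dilation ((2 * Real.pi)⁻¹ • (1 : Matrix (Fin d) (Fin d) ℝ))
      ((FourierTransform.fourier f : SchwartzMap (Euc d) ℂ).toLp 2) := by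
  rw [← SchwartzMap.toLp_fourier_eq]
  rfl

theorem fourier_act_smul_one (f : Euc d → ℂ) (s : Euc d) :
    FourierTransform.fourier f (act ((2 * Real.pi)⁻¹ • (1 : Matrix (Fin d) (Fin d) ℝ)) s)
      = ∫ t : Euc d, Complex.exp (-Complex.I * (∑ i, s i * t i : ℝ)) * f t := by
  rw [Real.fourier_eq']
  congr 1
  ext t
  have h : (inner ℝ t (act ((2 * Real.pi)⁻¹ • (1 : Matrix (Fin d) (Fin d) ℝ)) s) : ℝ)
      = (2 * Real.pi)⁻¹ * ∑ i, s i * t i := by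
    simp only [act, PiLp.inner_apply, Finset.mul_sum, Matrix.smul_mulVec, Matrix.one_mulVec,
      Pi.smul_apply, smul_eq_mul, RCLike.inner_apply, conj_trivial, mul_assoc]
  have hp : (-2 * Real.pi * ((2 * Real.pi)⁻¹ * ∑ i, s i * t i) : ℝ) = -∑ i, s i * t i := by
    have := Real.pi_ne_zero
    field_simp
  rw [h, smul_eq_mul, hp, Complex.ofReal_neg, neg_mul, neg_mul, mul_comm Complex.I]

/-- On Schwartz functions (a dense subspace of `L²`) the transform is given by the integral. -/
theorem coeFn_fourierL2_schwartz (f : SchwartzMap (Euc d) ℂ) :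
    (fourierL2 d (f.toLp 2) : Euc d → ℂ) =ᵐ[volume] fun s =>
      ((2 * Real.pi) ^ (-(d : ℝ) / 2) : ℝ) *
        ∫ t : Euc d, Complex.exp (-Complex.I * (∑ i, s i * t i : ℝ)) * f t := by
  have hpi : (0 : ℝ) < 2 * Real.pi := by positivity
  have hdet : ((2 * Real.pi)⁻¹ • (1 : Matrix (Fin d) (Fin d) ℝ)).det
      = ((2 * Real.pi)⁻¹) ^ d := by
    rw [Matrix.det_smul, Matrix.det_one, mul_one, Fintype.card_fin]
  have hne : ((2 * Real.pi)⁻¹ • (1 : Matrix (Fin d) (Fin d) ℝ)).det ≠ 0 := by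
    rw [hdet]; positivity
  have hc : Real.sqrt |((2 * Real.pi)⁻¹) ^ d| = (2 * Real.pi) ^ (-(d : ℝ) / 2) := by
    rw [abs_of_nonneg (by positivity), Real.sqrt_eq_rpow, ← Real.rpow_natCast,
      Real.inv_rpow hpi.le, ← Real.rpow_neg hpi.le, ← Real.rpow_mul hpi.le]
    ring_nf
  rw [fourierL2_toLp]
  filter_upwards [coeFn_dilation hne
      ((FourierTransform.fourier f : SchwartzMap (Euc d) ℂ).toLp 2),
    dilateFun_congr hne (SchwartzMap.coeFn_toLp
      (FourierTransform.fourier f : SchwartzMap (Euc d) ℂ) 2)] with s h1 h2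
  simp only [dilateFun] at h2
  rw [h1, h2, hdet, hc, SchwartzMap.fourier_coe, fourier_act_smul_one]

/-! ### Expansive matrices, frames and wavelets -/

/-- An integral matrix is expansive if all its (complex) eigenvalues have modulus `> 1`. -/
def IsExpansive (A : Matrix (Fin d) (Fin d) ℤ) : Prop :=
  ∀ β : ℂ, Module.End.HasEigenvalue (Matrix.toLin' (A.map (fun a : ℤ => (a : ℂ)))) β → 1 < ‖β‖

/-- `(e_i)` is a normalized tight frame (Parseval frame) of `L²(ℝ^d)`:
`∑ |⟨f, e_i⟩|² = ‖f‖²` for all `f`. -/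
def IsNormalizedTightFrame {ι : Type*} (e : ι → L2 d) : Prop :=
  ∀ f : L2 d, HasSum (fun i => ‖(inner ℂ f (e i) : ℂ)‖ ^ 2) (‖f‖ ^ 2)

/-- `ψ` is a Parseval frame wavelet associated with `A`: the family `D_A^n T_ℓ ψ`,
`n ∈ ℤ`, `ℓ ∈ ℤ^d`, is a normalized tight frame of `L²(ℝ^d)`. -/
def IsParsevalFrameWavelet (A : Matrix (Fin d) (Fin d) ℤ) (ψ : L2 d) : Prop :=
  IsNormalizedTightFrame fun p : ℤ × (Fin d → ℤ) =>
    (dilation (toReal A) ^ p.1) (translation (intVec p.2) ψ)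

/-- `V_B^{(0)}(f)`, the closed linear span of the integer translates of `f`. -/
def spaceZero (f : L2 d) : Submodule ℂ (L2 d) :=
  (Submodule.span ℂ (Set.range fun l : Fin d → ℤ => translation (intVec l) f)).topologicalClosure

/-- `V_B^{(n)}(f) = D_B^n V_B^{(0)}(f)`. -/
def space (B : Matrix (Fin d) (Fin d) ℤ) (f : L2 d) (n : ℤ) : Submodule ℂ (L2 d) :=
  (spaceZero f).map (dilation (toReal B) ^ n).toLinearEquiv.toLinearMap

/-! ### The partition properties and Lawton's equations -/

/-- The sublattice `A ℤ^d` of `ℤ^d`. -/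
def lattice (A : Matrix (Fin d) (Fin d) ℤ) : Set (Fin d → ℤ) :=
  Set.range fun n : Fin d → ℤ => A.mulVec n

/-- `A₀ = S⁻¹ A S` with `S` integral of determinant `±1`, and the matrix `A` has, with the vectors
`l = ℓ_A` and `q = q_A`, the five properties of the partition theorem. -/
structure PartitionData (A₀ A S : Matrix (Fin d) (Fin d) ℤ) (l q : Fin d → ℤ) : Prop where
  det_S : |S.det| = 1
  similar : A₀ = S⁻¹ * A * S
  lattice_transpose : lattice A = lattice A.transpose
  union_eq : (fun x => l + x) '' lattice A ∪ lattice A = Set.univ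
  disjoint : Disjoint ((fun x => l + x) '' lattice A) (lattice A)
  even : ∀ x ∈ lattice A, Even (dotProduct q x)
  odd : ∀ x ∈ lattice A, Odd (dotProduct q (l + x))
  union_eq' : ∀ m ∈ lattice A, ∀ n : Fin d → ℤ,
    (fun x => n - x) '' lattice A ∪ (fun x => l - m - n + x) '' lattice A = Set.univ
  disjoint' : ∀ m ∈ lattice A, ∀ n : Fin d → ℤ,
    Disjoint ((fun x => n - x) '' lattice A) ((fun x => l - m - n + x) '' lattice A)
  coset_eq : ∀ m ∈ (fun x => l + x) '' lattice A, ∀ n : Fin d → ℤ,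
    (fun x => n - x) '' lattice A = (fun x => l - m - n + x) '' lattice A

/-- The finite index set `Λ₀ = ℤ^d ∩ [-N₀, N₀]^d`. -/
def box (d N₀ : ℕ) : Finset (Fin d → ℤ) :=
  Finset.Icc (fun _ => -(N₀ : ℤ)) (fun _ => (N₀ : ℤ))

/-- `h` is a finite solution, supported in `Λ₀ = ℤ^d ∩ [-N₀, N₀]^d`, of Lawton's system of
equations associated with `A`. (The sums over `ℤ^d` have only finitely many nonzero terms.) -/
structure IsFiniteLawtonSolution (A : Matrix (Fin d) (Fin d) ℤ) (N₀ : ℕ)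
    (h : (Fin d → ℤ) → ℂ) : Prop where
  finite : ∀ n, n ∉ box d N₀ → h n = 0
  orthogonality : ∀ k ∈ lattice A,
    ∑ᶠ n : Fin d → ℤ, h n * (starRingEnd ℂ) (h (n + k)) = if k = 0 then 1 else 0
  normalization : ∑ᶠ n : Fin d → ℤ, h n = (Real.sqrt 2 : ℂ)

/-! ### Filter, scaling function and wavelet -/

/-- The filter `m₀(t) = (1/√2) ∑_n h_n exp(-i n·t)`. -/
def filterFun (h : (Fin d → ℤ) → ℂ) (t : Euc d) : ℂ :=
  (1 / Real.sqrt 2 : ℝ) *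
    ∑ᶠ n : Fin d → ℤ, h n * Complex.exp (-Complex.I * (∑ i, (n i : ℝ) * t i : ℝ))

/-- The factors `m₀((Aᵀ)^(-j) ξ)`, `j = 1, 2, …`, indexed by `j - 1`. -/
def factor (A : Matrix (Fin d) (Fin d) ℤ) (h : (Fin d → ℤ) → ℂ) (ξ : Euc d) (j : ℕ) : ℂ :=
  filterFun h (act ((toReal A).transpose⁻¹ ^ (j + 1)) ξ)

/-- `g(ξ) = (2π)^(-d/2) ∏_{j ≥ 1} m₀((Aᵀ)^(-j) ξ)`. -/
def scalingFourier (A : Matrix (Fin d) (Fin d) ℤ) (h : (Fin d → ℤ) → ℂ) (ξ : Euc d) : ℂ :=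
  ((2 * Real.pi) ^ (-(d : ℝ) / 2) : ℝ) * ∏' j : ℕ, factor A h ξ j

/-- The scaling function `φ_A = ℱ⁻¹ g`, once `g` is known to be square integrable. -/
def scaling (A : Matrix (Fin d) (Fin d) ℤ) (h : (Fin d → ℤ) → ℂ)
    (hg : MemLp (scalingFourier A h) 2 (volume : Measure (Euc d))) : L2 d :=
  (fourierL2 d).symm (hg.toLp (scalingFourier A h))

/-- `ψ_A = ∑_n (-1)^(q·n) conj(h_{ℓ-n}) D_A T_n φ`, for `l = ℓ_A`, `q = q_A`, `φ = φ_A`. -/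
def wavelet (A : Matrix (Fin d) (Fin d) ℤ) (l q : Fin d → ℤ) (h : (Fin d → ℤ) → ℂ)
    (φ : L2 d) : L2 d :=
  ∑ᶠ n : Fin d → ℤ, ((-1 : ℂ) ^ (dotProduct q n) * (starRingEnd ℂ) (h (l - n))) •
    dilation (toReal A) (translation (intVec n) φ)

/-- `φ_{A₀} = U_S φ_A`, that is `φ_{A₀}(t) = φ_A(S t)`, as `|det S| = 1`. -/
def scalingPullback (A S : Matrix (Fin d) (Fin d) ℤ) (h : (Fin d → ℤ) → ℂ)
    (hg : MemLp (scalingFourier A h) 2 (volume : Measure (Euc d))) : L2 d :=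
  dilation (toReal S) (scaling A h hg)

/-- `ψ_{A₀} = U_S ψ_A`, that is `ψ_{A₀}(t) = ψ_A(S t)`, as `|det S| = 1`. -/
def waveletPullback (A S : Matrix (Fin d) (Fin d) ℤ) (l q : Fin d → ℤ) (h : (Fin d → ℤ) → ℂ)
    (hg : MemLp (scalingFourier A h) 2 (volume : Measure (Euc d))) : L2 d :=
  dilation (toReal S) (wavelet A l q h (scaling A h hg))

end

end ParsevalWavelet

/-!
Modulo `2` the lattices `A₀ ℤ^d` and `A₀ᵀ ℤ^d` are hyperplanes, and an integral transvection `S`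
conjugates `A₀` to a matrix `A` for which they coincide; (P1)–(P5) are then statements about parity.

Starting from a function with Fourier transform the indicator of the unit cube, the refinement
operator `x ↦ ∑ h_n D_A T_n x` preserves orthonormality of the integer translates, by Lawton's
equations, and on the Fourier side its iterates converge pointwise to the infinite product of the
mask. Fatou's lemma makes the product square integrable and the translates of `φ` a Bessel sequence.
Lawton's equations also say that the polyphase matrix of the filter pair has orthonormal rows, so
that the coefficients of `f` against the translates of the wavelet have energy `E(1) - E(0)`, where
`E(n) = ∑_ℓ |⟨f, D_A^n T_ℓ φ⟩|²`. Summing the increments of `E` over all levels gives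
`E(∞) - E(-∞)`. Here `E(∞) = ‖f‖²`, since for band-limited `f` the Fourier series on the unit cube
yields an integral of `|f̂|²` against the product at a small argument; and `E(-∞) = 0`, since a
function of bounded support sees, after a large dilation, only small disjoint pieces of `φ`.
-/

namespace ParsevalWavelet

open scoped Matrix FourierTransform

noncomputable section

variable {d : ℕ}

/-! ### Sublattices of index two and the partition properties -/

section Parity

variable {ι : Type*}

/-- Reduction of an integral vector modulo `2`. -/
def modTwo : (ι → ℤ) →+ (ι → ZMod 2) := (Int.castAddHom (ZMod 2)).compLeft ι

@[simp]
theorem modTwo_apply (x : ι → ℤ) (i : ι) : modTwo x i = x i := rfl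

@[simp]
theorem modTwo_single [DecidableEq ι] (i : ι) (a : ℤ) :
    modTwo (Pi.single i a) = Pi.single i (a : ZMod 2) := by
  ext j
  by_cases h : j = i <;> simp [h]

variable [Fintype ι]

theorem exists_mem_iff_even_dotProduct {H : AddSubgroup (ι → ℤ)} (hH : H.index = 2) :
    ∃ q : ι → ℤ, ∀ x, x ∈ H ↔ Even (q ⬝ᵥ x) := by
  classical
  let f : (ι → ℤ) →+ ZMod 2 := AddMonoidHom.mk' (fun x => if x ∈ H then 0 else 1) fun x y => by
    have h11 : (1 : ZMod 2) + 1 = 0 := by decide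
    by_cases hx : x ∈ H <;> by_cases hy : y ∈ H <;>
      simp [AddSubgroup.add_mem_iff_of_index_two hH, hx, hy, h11]
  have mem_iff (x : ι → ℤ) : x ∈ H ↔ f x = 0 := by simp [f]
  refine ⟨fun i => (f (Pi.single i 1)).val, fun x => ?_⟩
  rw [mem_iff, ← ZMod.intCast_eq_zero_iff_even]
  have hfx : f x = ∑ i, x i * f (Pi.single i 1) := by
    conv_lhs => rw [pi_eq_sum_univ' x, map_sum]
    exact Finset.sum_congr rfl fun i _ => by rw [map_zsmul, zsmul_eq_mul]
  rw [hfx]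
  simp [dotProduct, mul_comm]

theorem index_range_mulVec [DecidableEq ι] {A : Matrix ι ι ℤ} (hA : A.det ≠ 0) :
    (LinearMap.range A.mulVecLin).toAddSubgroup.index = A.det.natAbs := by
  have h := Submodule.natAbs_det_equiv _
    (LinearEquiv.ofInjective A.mulVecLin (Matrix.mulVec_injective_of_det_ne_zero hA))
  rw [show (LinearMap.range A.mulVecLin).subtype ∘ₗ _ = Matrix.toLin' A from rfl,
    LinearMap.det_toLin'] at h
  exact h.symm

theorem even_dotProduct_iff (q x : ι → ℤ) : Even (q ⬝ᵥ x) ↔ modTwo q ⬝ᵥ modTwo x = 0 := by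
  rw [← ZMod.intCast_eq_zero_iff_even]
  simp [dotProduct, modTwo]

theorem modTwo_ne_zero_of_odd_dotProduct {q x : ι → ℤ} (h : Odd (q ⬝ᵥ x)) : modTwo q ≠ 0 := by
  intro h0
  rw [← Int.not_even_iff_odd, even_dotProduct_iff, h0, zero_dotProduct] at h
  exact h rfl

theorem zmod_two_eq_zero_or_one (z : ZMod 2) : z = 0 ∨ z = 1 := by
  revert z; decide

/-- The vector `v` is lifted with `u ⬝ᵥ v = 0` in `ℤ`, not only modulo `2`, so that the
transvection built from `u` and `v` is an integral unimodular matrix. -/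
theorem exists_modTwo_eq_add_dotProduct_eq_zero {p q : ι → ZMod 2} (hp : p ≠ 0) (hq : q ≠ 0) :
    ∃ u v : ι → ℤ, u ⬝ᵥ v = 0 ∧ modTwo v = p + q ∧ modTwo u ⬝ᵥ p = 1 := by
  classical
  have modTwo_lift : modTwo (fun i => ((p i + q i).val : ℤ)) = p + q := by
    ext i; simp
  by_cases h : ∃ i, p i = 1 ∧ q i = 1
  · obtain ⟨i, hpi, hqi⟩ := h
    refine ⟨Pi.single i 1, _, ?_, modTwo_lift, ?_⟩
    · rw [single_dotProduct, hpi, hqi]; decide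
    · simp [hpi]
  · push Not at h
    obtain ⟨i, hi⟩ := Function.ne_iff.mp hp
    obtain ⟨j, hj⟩ := Function.ne_iff.mp hq
    have hpi : p i = 1 := (zmod_two_eq_zero_or_one _).resolve_left hi
    have hqj : q j = 1 := (zmod_two_eq_zero_or_one _).resolve_left hj
    have hqi : q i = 0 := (zmod_two_eq_zero_or_one _).resolve_right (h i hpi)
    have hpj : p j = 0 := (zmod_two_eq_zero_or_one _).resolve_right fun h' => h j h' hqj
    refine ⟨Pi.single i 1 - Pi.single j 1, _, ?_, modTwo_lift, ?_⟩
    · rw [sub_dotProduct, single_dotProduct, single_dotProduct, hpi, hqi, hpj, hqj]; decide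
    · simp [sub_dotProduct, hpi, hpj]

theorem exists_transvection_of_dotProduct_eq {p q : ι → ZMod 2} (hp : p ≠ 0) (hq : q ≠ 0)
    (h : p ⬝ᵥ q = q ⬝ᵥ q) :
    ∃ u w : ι → ℤ, u ⬝ᵥ w = 0 ∧
      p + (modTwo u ⬝ᵥ p) • modTwo w = q + (q ⬝ᵥ modTwo w) • modTwo u := by
  obtain ⟨u, w, huw, hw, hup⟩ := exists_modTwo_eq_add_dotProduct_eq_zero hp hq
  refine ⟨u, w, huw, ?_⟩
  have hqw : q ⬝ᵥ modTwo w = 0 := by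
    rw [hw, dotProduct_add, dotProduct_comm q p, h, CharTwo.add_self_eq_zero]
  rw [hup, hqw, hw, one_smul, zero_smul, add_zero]
  ext i
  simp only [Pi.add_apply]
  rw [← add_assoc, CharTwo.add_self_eq_zero, zero_add]

/-- Any two nonzero vectors over `𝔽₂` are moved to the same vector by an integral transvection
`1 + w uᵀ` and the transpose `1 + u wᵀ` of its inverse. -/
theorem exists_transvection {p q : ι → ZMod 2} (hp : p ≠ 0) (hq : q ≠ 0) :
    ∃ u w : ι → ℤ, u ⬝ᵥ w = 0 ∧
      p + (modTwo u ⬝ᵥ p) • modTwo w = q + (q ⬝ᵥ modTwo w) • modTwo u := by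
  classical
  by_cases hpq : p ⬝ᵥ q = q ⬝ᵥ q
  · exact exists_transvection_of_dotProduct_eq hp hq hpq
  by_cases hqp : q ⬝ᵥ p = p ⬝ᵥ p
  · obtain ⟨u, w, huw, h⟩ := exists_transvection_of_dotProduct_eq hq hp hqp
    exact ⟨w, u, by rwa [dotProduct_comm], by
      rw [dotProduct_comm _ p, dotProduct_comm q, h]⟩
  obtain ⟨i, hpi, hqi⟩ : ∃ i, p i = 0 ∧ q i = 1 := by
    by_contra! h
    refine hpq (Finset.sum_congr rfl fun i _ => ?_)
    rcases zmod_two_eq_zero_or_one (p i) with hi | hi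
    · rw [hi, (zmod_two_eq_zero_or_one _).resolve_right (h i hi)]
    · rcases zmod_two_eq_zero_or_one (q i) with hj | hj <;> simp [hi, hj]
  have hsum : p ⬝ᵥ p + q ⬝ᵥ p = 1 := by
    rcases zmod_two_eq_zero_or_one (p ⬝ᵥ p) with h | h <;>
    rcases zmod_two_eq_zero_or_one (q ⬝ᵥ p) with h' | h' <;> simp_all
  have hu : modTwo (fun k => (((p + q + Pi.single i 1 : ι → ZMod 2) k).val : ℤ))
      = p + q + Pi.single i 1 := by
    ext k; simp
  refine ⟨fun k => ((p + q + Pi.single i 1 : ι → ZMod 2) k).val, Pi.single i 1, ?_, ?_⟩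
  · simp only [dotProduct_single, Pi.add_apply, Pi.single_eq_same, hpi, hqi]; decide
  · have hup : (p + q + Pi.single i 1) ⬝ᵥ p = 1 := by
      rw [add_dotProduct, add_dotProduct, hsum, single_dotProduct, hpi, mul_zero, add_zero]
    rw [hu, modTwo_single, Int.cast_one, hup, dotProduct_single, hqi, mul_one, one_smul, one_smul]
    ext k
    simp only [Pi.add_apply]
    linear_combination (CharTwo.add_self_eq_zero (q k)).symm

end Parity

theorem exists_mem_lattice_iff_even {A : Matrix (Fin d) (Fin d) ℤ} (hA : A.det.natAbs = 2) :
    ∃ q : Fin d → ℤ, (∀ x, x ∈ lattice A ↔ Even (q ⬝ᵥ x)) ∧ ∃ l, Odd (q ⬝ᵥ l) := by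
  have hindex : (LinearMap.range A.mulVecLin).toAddSubgroup.index = 2 :=
    hA ▸ index_range_mulVec fun h => by simp [h] at hA
  obtain ⟨q, hq⟩ := exists_mem_iff_even_dotProduct hindex
  obtain ⟨l, hl⟩ := AddSubgroup.index_eq_two_iff.mp hindex
  refine ⟨q, hq, l, ?_⟩
  rw [← Int.not_even_iff_odd, ← hq]
  exact fun h => (hl 0).elim (fun h0 => h0.2 (zero_mem _)) fun h0 => h0.2 (by rwa [zero_add])

theorem mem_lattice_conj {A S T : Matrix (Fin d) (Fin d) ℤ} (hST : S * T = 1)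
    (x : Fin d → ℤ) : x ∈ lattice (S * A * T) ↔ T *ᵥ x ∈ lattice A := by
  have hTS : T * S = 1 := mul_eq_one_comm.mp hST
  constructor
  · rintro ⟨n, rfl⟩
    exact ⟨T *ᵥ n, by simp only [Matrix.mulVec_mulVec, ← mul_assoc, hTS, one_mul]⟩
  · rintro ⟨n, hn : A *ᵥ n = T *ᵥ x⟩
    refine ⟨S *ᵥ n, show (S * A * T) *ᵥ S *ᵥ n = x from ?_⟩
    rw [← Matrix.mulVec_mulVec, Matrix.mulVec_mulVec _ T, hTS, Matrix.one_mulVec,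
      ← Matrix.mulVec_mulVec, hn, Matrix.mulVec_mulVec, hST, Matrix.one_mulVec]

section PartitionData

variable {A₀ A S : Matrix (Fin d) (Fin d) ℤ} {l q : Fin d → ℤ}

theorem mem_add_image_lattice_iff (hq : ∀ x, x ∈ lattice A ↔ Even (q ⬝ᵥ x)) (a x : Fin d → ℤ) :
    x ∈ (fun y => a + y) '' lattice A ↔ (Even (q ⬝ᵥ x) ↔ Even (q ⬝ᵥ a)) := by
  rw [← Int.even_sub, ← dotProduct_sub, ← hq]
  exact ⟨by rintro ⟨y, hy, rfl⟩; simpa using hy, fun h => ⟨_, h, by simp⟩⟩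

theorem mem_sub_image_lattice_iff (hq : ∀ x, x ∈ lattice A ↔ Even (q ⬝ᵥ x)) (a x : Fin d → ℤ) :
    x ∈ (fun y => a - y) '' lattice A ↔ (Even (q ⬝ᵥ x) ↔ Even (q ⬝ᵥ a)) := by
  rw [iff_comm (a := Even (q ⬝ᵥ x)), ← Int.even_sub, ← dotProduct_sub, ← hq]
  exact ⟨by rintro ⟨y, hy, rfl⟩; simpa using hy, fun h => ⟨_, h, by simp⟩⟩

theorem PartitionData.of_parity (hS : |S.det| = 1) (hsim : A₀ = S⁻¹ * A * S)
    (htr : lattice A = lattice Aᵀ) (hq : ∀ x, x ∈ lattice A ↔ Even (q ⬝ᵥ x))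
    (hl : Odd (q ⬝ᵥ l)) : PartitionData A₀ A S l q := by
  have hl' : ¬ Even (q ⬝ᵥ l) := Int.not_even_iff_odd.mpr hl
  have hadd := mem_add_image_lattice_iff hq
  have hsub := mem_sub_image_lattice_iff hq
  refine ⟨hS, hsim, htr, ?_, ?_, fun x hx => (hq x).mp hx, fun x hx => ?_, fun m hm n => ?_,
    fun m hm n => ?_, fun m hm n => ?_⟩
  · ext x
    rw [Set.mem_union, hadd, hq]
    simp only [hl', iff_false, Set.mem_univ, iff_true]
    tauto
  · refine Set.disjoint_left.mpr fun x hx => ?_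
    rw [hadd] at hx
    rw [hq]
    tauto
  · rw [dotProduct_add]
    exact hl.add_even ((hq x).mp hx)
  · ext x
    rw [hq] at hm
    rw [Set.mem_union, hadd, hsub, dotProduct_sub, dotProduct_sub, Int.even_sub, Int.even_sub]
    simp only [Set.mem_univ, iff_true]
    tauto
  · refine Set.disjoint_left.mpr fun x hx => ?_
    rw [hq] at hm
    rw [hsub] at hx
    rw [hadd, dotProduct_sub, dotProduct_sub, Int.even_sub, Int.even_sub]
    tauto
  · ext x
    rw [hadd] at hm
    rw [hadd, hsub, dotProduct_sub, dotProduct_sub, Int.even_sub, Int.even_sub]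
    tauto

theorem PartitionData.mem_lattice_iff_even (hP : PartitionData A₀ A S l q) (x : Fin d → ℤ) :
    x ∈ lattice A ↔ Even (q ⬝ᵥ x) := by
  refine ⟨hP.even x, fun hx => ?_⟩
  rcases hP.union_eq ▸ Set.mem_univ x with ⟨y, hy, rfl⟩ | h
  · exact absurd hx (Int.not_even_iff_odd.mpr (hP.odd y hy))
  · exact h

theorem PartitionData.odd_shift (hP : PartitionData A₀ A S l q) : Odd (q ⬝ᵥ l) := by
  simpa using hP.odd 0 ⟨0, by simp⟩

theorem PartitionData.isUnit_det_S (hP : PartitionData A₀ A S l q) : IsUnit S.det :=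
  Int.isUnit_iff_abs_eq.mpr hP.det_S

end PartitionData

/-- If `A₀ ℤ^d = ker q` and `A₀ᵀ ℤ^d = ker p` modulo `2`, then `S A₀ S⁻¹` and its transpose have
the lattices `ker (S⁻ᵀ q)` and `ker (S p)`. A transvection `S` makes them equal. -/
theorem exists_partitionData (A₀ : Matrix (Fin d) (Fin d) ℤ) (hdet : A₀.det.natAbs = 2) :
    ∃ (A S : Matrix (Fin d) (Fin d) ℤ) (l q : Fin d → ℤ), PartitionData A₀ A S l q := by
  obtain ⟨q, hq, l, hl⟩ := exists_mem_lattice_iff_even hdet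
  obtain ⟨p, hp, l', hl'⟩ := exists_mem_lattice_iff_even (A := A₀ᵀ) (by rwa [Matrix.det_transpose])
  obtain ⟨u, w, huw, hpq⟩ := exists_transvection (modTwo_ne_zero_of_odd_dotProduct hl')
    (modTwo_ne_zero_of_odd_dotProduct hl)
  let S : Matrix (Fin d) (Fin d) ℤ := 1 + Matrix.vecMulVec w u
  let T : Matrix (Fin d) (Fin d) ℤ := 1 - Matrix.vecMulVec w u
  have hST : S * T = 1 := by
    simp [S, T, mul_sub, add_mul, Matrix.vecMulVec_mul_vecMulVec, huw]
  have hTS : T * S = 1 := mul_eq_one_comm.mp hST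
  have hS : IsUnit S.det := Matrix.isUnit_det_of_right_inverse hST
  have hlattice (x) : x ∈ lattice (S * A₀ * T) ↔ Even ((q ᵥ* T) ⬝ᵥ x) := by
    rw [mem_lattice_conj hST, hq, Matrix.dotProduct_mulVec]
  have hlattice_transpose (x) : x ∈ lattice (S * A₀ * T)ᵀ ↔ Even ((S *ᵥ p) ⬝ᵥ x) := by
    rw [Matrix.transpose_mul, Matrix.transpose_mul, ← mul_assoc, mem_lattice_conj
      (by rw [← Matrix.transpose_mul, hST, Matrix.transpose_one]), hp, Matrix.dotProduct_mulVec,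
      Matrix.vecMul_transpose]
  have hmod : modTwo (S *ᵥ p) = modTwo (q ᵥ* T) := by
    have hSp : modTwo (S *ᵥ p) = modTwo p + (modTwo u ⬝ᵥ modTwo p) • modTwo w := by
      ext i
      simp [S, Matrix.add_mulVec, Matrix.vecMulVec_mulVec, dotProduct, mul_comm]
    have hqT : modTwo (q ᵥ* T) = modTwo q + (modTwo q ⬝ᵥ modTwo w) • modTwo u := by
      ext i
      simp only [T, Matrix.vecMul_sub, Matrix.vecMul_one, Matrix.vecMul_vecMulVec, map_sub]
      simp [dotProduct, CharTwo.sub_eq_add]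
    rw [hSp, hqT, hpq]
  refine ⟨S * A₀ * T, S, S *ᵥ l, q ᵥ* T,
    .of_parity (Int.isUnit_iff_abs_eq.mp hS) ?_ ?_ hlattice ?_⟩
  · rw [Matrix.inv_eq_right_inv hST, ← mul_assoc, ← mul_assoc, hTS, one_mul, mul_assoc, hTS,
      mul_one]
  · ext x
    rw [hlattice, hlattice_transpose, even_dotProduct_iff, even_dotProduct_iff, hmod]
  · rwa [← Matrix.dotProduct_mulVec, Matrix.mulVec_mulVec, hTS, Matrix.one_mulVec]

/-! ### Translations, dilations and the Fourier transform -/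

section Matrix

variable {M N : Matrix (Fin d) (Fin d) ℝ}

theorem act_sub (M : Matrix (Fin d) (Fin d) ℝ) (s t : Euc d) :
    act M (s - t) = act M s - act M t := by
  rw [act_eq_toEuclideanLin, map_sub]

theorem continuous_act (M : Matrix (Fin d) (Fin d) ℝ) : Continuous (act M) := by
  rw [act_eq_toEuclideanLin]
  exact LinearMap.continuous_of_finiteDimensional _

theorem inner_act (M : Matrix (Fin d) (Fin d) ℝ) (s t : Euc d) :
    inner ℝ (act M s) t = inner ℝ s (act Mᵀ t) := by
  simp only [act, EuclideanSpace.inner_eq_star_dotProduct, star_trivial]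
  rw [Matrix.dotProduct_mulVec, Matrix.mulVec_transpose]

theorem act_inv_act (hM : M.det ≠ 0) (t : Euc d) : act M⁻¹ (act M t) = t := by
  rw [act_mul, Matrix.nonsing_inv_mul _ hM.isUnit, act_one]

theorem act_act_inv (hM : M.det ≠ 0) (t : Euc d) : act M (act M⁻¹ t) = t := by
  rw [act_mul, Matrix.mul_nonsing_inv _ hM.isUnit, act_one]

theorem det_transpose_ne_zero (hM : M.det ≠ 0) : Mᵀ.det ≠ 0 := by
  rwa [Matrix.det_transpose]

theorem det_inv_ne_zero (hM : M.det ≠ 0) : M⁻¹.det ≠ 0 := by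
  rw [Matrix.det_nonsing_inv]
  exact hM.isUnit.ringInverse.ne_zero

theorem det_transpose_inv_ne_zero (hM : M.det ≠ 0) : Mᵀ⁻¹.det ≠ 0 :=
  det_inv_ne_zero (det_transpose_ne_zero hM)

/-- The action of an invertible matrix, as a continuous linear equivalence. -/
def actEquiv (hM : M.det ≠ 0) : Euc d ≃L[ℝ] Euc d :=
  ContinuousLinearEquiv.equivOfInverse (Matrix.toEuclideanLin M).toContinuousLinearMap
    (Matrix.toEuclideanLin M⁻¹).toContinuousLinearMap (act_inv_act hM) (act_act_inv hM)

theorem integral_comp_act {E : Type*} [NormedAddCommGroup E] [NormedSpace ℝ E] (hM : M.det ≠ 0)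
    (f : Euc d → E) : ∫ t, f (act M t) = |M.det⁻¹| • ∫ t, f t := by
  have hemb : MeasurableEmbedding (act M) := (actEquiv hM).toHomeomorph.measurableEmbedding
  rw [← hemb.integral_map, map_act_volume hM, integral_smul_measure,
    ENNReal.toReal_ofReal (abs_nonneg _)]

theorem dilation_dilation (hM : M.det ≠ 0) (hN : N.det ≠ 0) (f : L2 d) :
    dilation M (dilation N f) = dilation (N * M) f := by
  have hNM : (N * M).det ≠ 0 := by rw [Matrix.det_mul]; exact mul_ne_zero hN hM
  refine Lp.ext ((coeFn_dilation hM _).trans (.trans ?_ (coeFn_dilation hNM f).symm))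
  change _ =ᵐ[volume] dilateFun (N * M) f
  rw [← dilateFun_dilateFun]
  exact dilateFun_congr hM (coeFn_dilation hN f)

theorem dilation_one (f : L2 d) : dilation 1 f = f := by
  refine Lp.ext ((coeFn_dilation (by simp) f).trans (.of_eq ?_))
  exact dilateFun_one f

theorem dilation_pow (hM : M.det ≠ 0) (n : ℕ) (f : L2 d) :
    (dilation M ^ n) f = dilation (M ^ n) f := by
  induction n with
  | zero => rw [pow_zero, pow_zero, dilation_one]; rfl
  | succ n ih =>
    rw [pow_succ', LinearIsometryEquiv.coe_mul, Function.comp_apply, ih,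
      dilation_dilation hM (by rw [Matrix.det_pow]; exact pow_ne_zero _ hM), pow_succ]

theorem dilation_inv (hM : M.det ≠ 0) : (dilation M)⁻¹ = dilation M⁻¹ := by
  refine LinearIsometryEquiv.ext fun f => ?_
  change (dilation M).symm f = _
  rw [LinearIsometryEquiv.symm_apply_eq, dilation_dilation hM (det_inv_ne_zero hM),
    Matrix.nonsing_inv_mul _ hM.isUnit, dilation_one]

end Matrix

section Lattice

theorem intVec_zero : intVec (0 : Fin d → ℤ) = 0 := by
  ext i; simp [intVec]

theorem intVec_add (m n : Fin d → ℤ) : intVec (m + n) = intVec m + intVec n := by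
  ext i; simp [intVec]

theorem intVec_neg (m : Fin d → ℤ) : intVec (-m) = -intVec m := by
  ext i; simp [intVec]

theorem act_intVec (A : Matrix (Fin d) (Fin d) ℤ) (n : Fin d → ℤ) :
    act (toReal A) (intVec n) = intVec (A *ᵥ n) := by
  ext i
  simp [act, intVec, toReal, Matrix.mulVec, dotProduct]

theorem det_toReal (A : Matrix (Fin d) (Fin d) ℤ) : (toReal A).det = (A.det : ℝ) :=
  (Int.cast_det A).symm

theorem det_toReal_ne_zero {A : Matrix (Fin d) (Fin d) ℤ} (hA : A.det ≠ 0) :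
    (toReal A).det ≠ 0 := by
  rw [det_toReal]
  exact_mod_cast hA

theorem toReal_mul (A B : Matrix (Fin d) (Fin d) ℤ) : toReal (A * B) = toReal A * toReal B :=
  Matrix.map_mul (f := Int.castRingHom ℝ)

end Lattice

section Translation

theorem quasiMeasurePreserving_sub_const (v : Euc d) :
    Measure.QuasiMeasurePreserving (· - v) (volume : Measure (Euc d)) volume :=
  (measurePreserving_sub_right volume v).quasiMeasurePreserving

theorem translation_add (v w : Euc d) (f : L2 d) :
    translation v (translation w f) = translation (v + w) f := by
  apply Lp.ext
  filter_upwards [coeFn_translation v (translation w f), coeFn_translation (v + w) f,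
    (quasiMeasurePreserving_sub_const v).ae (coeFn_translation w f)] with t h₁ h₂ h₃
  rw [h₁, h₂, h₃, sub_sub]

theorem translation_zero (f : L2 d) : translation 0 f = f := by
  apply Lp.ext
  filter_upwards [coeFn_translation 0 f] with t ht
  rw [ht, sub_zero]

theorem translation_dilation {M : Matrix (Fin d) (Fin d) ℝ} (hM : M.det ≠ 0) (v : Euc d)
    (f : L2 d) : translation v (dilation M f) = dilation M (translation (act M v) f) := by
  apply Lp.ext
  filter_upwards [coeFn_translation v (dilation M f),
    (quasiMeasurePreserving_sub_const v).ae (coeFn_dilation hM f),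
    coeFn_dilation hM (translation (act M v) f),
    (quasiMeasurePreserving_act hM).ae (coeFn_translation (act M v) f)] with t h₁ h₂ h₃ h₄
  rw [h₁, h₂, h₃, h₄, act_sub]

end Translation

section Wave

/-- The character `s ↦ exp(-2πi v·s)` of `ℝ^d`, in Mathlib's normalization of the Fourier
transform. -/
def wave (v s : Euc d) : ℂ := Real.fourierChar (-inner ℝ v s)

theorem wave_eq_exp (v s : Euc d) :
    wave v s = Complex.exp ((-(2 * Real.pi * inner ℝ v s) : ℝ) * Complex.I) := by
  rw [wave, Real.fourierChar_apply, mul_neg]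

theorem norm_wave (v s : Euc d) : ‖wave v s‖ = 1 := Circle.norm_coe _

theorem wave_add_left (v w s : Euc d) : wave (v + w) s = wave v s * wave w s := by
  rw [wave, inner_add_left, neg_add, AddChar.map_add_eq_mul, Circle.coe_mul, wave, wave]

theorem wave_zero_left (s : Euc d) : wave 0 s = 1 := by simp [wave]

theorem conj_wave (v s : Euc d) : (starRingEnd ℂ) (wave v s) = wave (-v) s := by
  rw [wave, wave, ← Circle.coe_inv_eq_conj, ← AddChar.map_neg_eq_inv, inner_neg_left]

theorem continuous_wave (v : Euc d) : Continuous (wave v) := by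
  unfold wave
  fun_prop

theorem memLp_wave_mul (v : Euc d) {f : Euc d → ℂ} (hf : MemLp f 2 volume) :
    MemLp (fun s => wave v s * f s) 2 volume :=
  hf.of_le ((continuous_wave v).aestronglyMeasurable.mul hf.1)
    (.of_forall fun s => by rw [norm_mul, norm_wave, one_mul])

/-- Multiplication by the character `exp(-2πi v·s)` on `L²(ℝ^d)`. -/
def modulation (v : Euc d) : L2 d →ₗᵢ[ℂ] L2 d where
  toFun f := (memLp_wave_mul v (Lp.memLp f)).toLp _
  map_add' f g := by
    rw [← MemLp.toLp_add]
    refine MemLp.toLp_congr _ _ ?_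
    filter_upwards [Lp.coeFn_add f g] with s hs
    rw [hs, Pi.add_apply, mul_add, Pi.add_apply]
  map_smul' c f := by
    rw [RingHom.id_apply, ← MemLp.toLp_const_smul]
    refine MemLp.toLp_congr _ _ ?_
    filter_upwards [Lp.coeFn_smul c f] with s hs
    rw [hs, Pi.smul_apply, mul_smul_comm, Pi.smul_apply]
  norm_map' f := by
    change ‖(memLp_wave_mul v (Lp.memLp f)).toLp _‖ = ‖f‖
    rw [Lp.norm_toLp, Lp.norm_def]
    congr 1
    exact eLpNorm_congr_norm_ae (.of_forall fun s => by rw [norm_mul, norm_wave, one_mul])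

theorem coeFn_modulation (v : Euc d) (f : L2 d) :
    (modulation v f : Euc d → ℂ) =ᵐ[volume] fun s => wave v s * f s :=
  (memLp_wave_mul v (Lp.memLp f)).coeFn_toLp

end Wave

section Fourier

theorem fourier_comp_sub (f : Euc d → ℂ) (v s : Euc d) :
    𝓕 (fun t => f (t - v)) s = wave v s * 𝓕 f s := by
  have h := congrFun (VectorFourier.fourierIntegral_comp_add_right Real.fourierChar volume
    (innerₗ (Euc d)) f (-v)) s
  rw [innerₗ_apply_apply, inner_neg_left] at h
  simp only [← sub_eq_add_neg] at h
  exact h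

theorem fourier_comp_act {M : Matrix (Fin d) (Fin d) ℝ} (hM : M.det ≠ 0) (f : Euc d → ℂ)
    (s : Euc d) : 𝓕 (fun t => f (act M t)) s = |M.det⁻¹| • 𝓕 f (act Mᵀ⁻¹ s) := by
  rw [Real.fourier_eq, Real.fourier_eq, ← integral_comp_act hM]
  simp only [inner_act, act_act_inv (det_transpose_ne_zero hM)]

/-- The Fourier transform on `L²(ℝ^d)` in the normalization `∫ exp(-2πi s·t) f(t) dt`. -/
abbrev FT (d : ℕ) : L2 d ≃ₗᵢ[ℂ] L2 d := Lp.fourierTransformₗᵢ (Euc d) ℂ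

theorem FT_toLp (f : SchwartzMap (Euc d) ℂ) : FT d (f.toLp 2) = (𝓕 f).toLp 2 := by
  rw [← SchwartzMap.toLp_fourier_eq]
  rfl

theorem eq_of_forall_schwartz {T U : L2 d → L2 d} (hT : Continuous T) (hU : Continuous U)
    (h : ∀ f : SchwartzMap (Euc d) ℂ, T (f.toLp 2) = U (f.toLp 2)) : T = U :=
  (SchwartzMap.denseRange_toLpCLM (p := 2) ENNReal.ofNat_ne_top).equalizer hT hU (funext h)

theorem translation_toLp (v : Euc d) (f : SchwartzMap (Euc d) ℂ) :
    translation v (f.toLp 2) = (f.compSubConstCLM ℂ v).toLp 2 := by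
  apply Lp.ext
  filter_upwards [coeFn_translation v (f.toLp 2), (f.compSubConstCLM ℂ v).coeFn_toLp 2,
    (quasiMeasurePreserving_sub_const v).ae (f.coeFn_toLp 2 volume)] with t h₁ h₂ h₃
  rw [h₁, h₂, h₃, SchwartzMap.compSubConstCLM_apply]

theorem dilation_toLp {M : Matrix (Fin d) (Fin d) ℝ} (hM : M.det ≠ 0)
    (f : SchwartzMap (Euc d) ℂ) : dilation M (f.toLp 2) =
      (√|M.det| • f.compCLMOfContinuousLinearEquiv ℂ (actEquiv hM)).toLp 2 := by
  apply Lp.ext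
  filter_upwards [coeFn_dilation hM (f.toLp 2),
    (√|M.det| • f.compCLMOfContinuousLinearEquiv ℂ (actEquiv hM)).coeFn_toLp 2,
    (quasiMeasurePreserving_act hM).ae (f.coeFn_toLp 2 volume)] with t h₁ h₂ h₃
  rw [h₁, h₂, h₃]
  rfl

theorem FT_translation (v : Euc d) (f : L2 d) :
    FT d (translation v f) = modulation v (FT d f) := by
  refine congrFun (eq_of_forall_schwartz ((FT d).continuous.comp (translation v).continuous)
    ((modulation v).continuous.comp (FT d).continuous) fun f => ?_) f
  rw [Function.comp_apply, Function.comp_apply]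
  rw [translation_toLp, FT_toLp, FT_toLp]
  apply Lp.ext
  filter_upwards [(𝓕 (f.compSubConstCLM ℂ v)).coeFn_toLp 2, coeFn_modulation v ((𝓕 f).toLp 2),
    (𝓕 f).coeFn_toLp 2] with s h₁ h₂ h₃
  rw [h₁, h₂, h₃, SchwartzMap.fourier_coe, SchwartzMap.fourier_coe]
  exact fourier_comp_sub f v s

theorem FT_dilation {M : Matrix (Fin d) (Fin d) ℝ} (hM : M.det ≠ 0) (f : L2 d) :
    FT d (dilation M f) = dilation Mᵀ⁻¹ (FT d f) := by
  refine congrFun (eq_of_forall_schwartz ((FT d).continuous.comp (dilation M).continuous)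
    ((dilation Mᵀ⁻¹).continuous.comp (FT d).continuous) fun f => ?_) f
  rw [Function.comp_apply, Function.comp_apply]
  have hM' := det_transpose_inv_ne_zero hM
  have hscale : √|M.det| * |M.det⁻¹| = √|Mᵀ⁻¹.det| := by
    rw [Matrix.det_nonsing_inv, Matrix.det_transpose, Ring.inverse_eq_inv', abs_inv, Real.sqrt_inv,
      ← div_eq_mul_inv, Real.sqrt_div_self', one_div]
  rw [dilation_toLp hM, FT_toLp, FT_toLp, FourierTransform.fourier_smul]
  apply Lp.ext
  filter_upwards [(√|M.det| • 𝓕 (f.compCLMOfContinuousLinearEquiv ℂ (actEquiv hM))).coeFn_toLp 2,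
    coeFn_dilation hM' ((𝓕 f).toLp 2),
    (quasiMeasurePreserving_act hM').ae ((𝓕 f).coeFn_toLp 2 volume)] with s h₁ h₂ h₃
  rw [h₁, h₂, h₃, _root_.smul_apply, SchwartzMap.fourier_coe, SchwartzMap.fourier_coe,
    ← hscale, Complex.ofReal_mul, mul_assoc, ← Complex.real_smul, ← Complex.real_smul]
  exact congrArg _ (fourier_comp_act hM f s)

end Fourier

/-! ### Expansive matrices -/

section Expansive

/-- The powers of `M` contract `ℝ^d` at a geometric rate. -/
def IsContracting (M : Matrix (Fin d) (Fin d) ℝ) : Prop :=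
  ∃ C r : ℝ, 0 ≤ C ∧ 0 ≤ r ∧ r < 1 ∧ ∀ (n : ℕ) (t : Euc d), ‖act (M ^ n) t‖ ≤ C * r ^ n * ‖t‖

theorem exists_norm_pow_le_of_spectralRadius_lt_one {R : Type*} [NormedRing R]
    [NormedAlgebra ℂ R] [CompleteSpace R] {a : R} (ha : spectralRadius ℂ a < 1) :
    ∃ C r : ℝ, 0 ≤ C ∧ 0 ≤ r ∧ r < 1 ∧ ∀ n : ℕ, ‖a ^ n‖ ≤ C * r ^ n := by
  obtain ⟨r, har, hr1⟩ := ENNReal.lt_iff_exists_nnreal_btwn.mp ha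
  have hr0 : (0 : ℝ) < r := NNReal.coe_pos.mpr (ENNReal.coe_pos.mp (bot_le.trans_lt har))
  have hgelfand : ∀ᶠ n : ℕ in Filter.atTop, ‖a ^ n‖ ≤ (r : ℝ) ^ n := by
    filter_upwards [(spectrum.pow_nnnorm_pow_one_div_tendsto_nhds_spectralRadius
      a).eventually_lt_const har, Filter.eventually_gt_atTop 0] with n hn hn0
    rw [one_div, ENNReal.rpow_inv_lt_iff (Nat.cast_pos.mpr hn0), ENNReal.rpow_natCast] at hn
    exact_mod_cast hn.le
  obtain ⟨C, hC, hbound⟩ := Asymptotics.bound_of_isBigO_nat_atTop (f := fun n : ℕ => ‖a ^ n‖)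
    (g'' := fun n : ℕ => (r : ℝ) ^ n) <| .of_bound 1 <| hgelfand.mono fun n hn => by simpa using hn
  refine ⟨C, r, hC.le, hr0.le, by exact_mod_cast hr1, fun n => ?_⟩
  simpa using hbound (x := n) (pow_pos hr0 n).ne'

open scoped Matrix.Norms.L2Operator in
theorem norm_act_le (M : Matrix (Fin d) (Fin d) ℝ) (t : Euc d) :
    ‖act M t‖ ≤ ‖Complex.ofRealHom.mapMatrix M‖ * ‖t‖ := by
  let toComplex (s : Euc d) : EuclideanSpace ℂ (Fin d) := WithLp.toLp 2 fun i => (s i : ℂ)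
  have norm_toComplex (s : Euc d) : ‖toComplex s‖ = ‖s‖ := by
    simp [EuclideanSpace.norm_eq, toComplex]
  have hact : toComplex (act M t) =
      WithLp.toLp 2 (Complex.ofRealHom.mapMatrix M *ᵥ (toComplex t).ofLp) := by
    ext i
    simp [toComplex, act, Matrix.mulVec, dotProduct]
  rw [← norm_toComplex, ← norm_toComplex t, hact]
  exact Matrix.l2_opNorm_mulVec _ _

open scoped Matrix.Norms.L2Operator in
theorem isContracting_of_spectrum {M : Matrix (Fin d) (Fin d) ℝ}
    (hM : ∀ z ∈ spectrum ℂ (Complex.ofRealHom.mapMatrix M), ‖z‖ < 1) : IsContracting M := by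
  have hradius : spectralRadius ℂ (Complex.ofRealHom.mapMatrix M) < 1 := by
    rcases subsingleton_or_nontrivial (Matrix (Fin d) (Fin d) ℂ)
    · rw [spectrum.SpectralRadius.of_subsingleton]
      exact one_pos
    · exact spectrum.spectralRadius_lt_of_forall_lt _ hM
  obtain ⟨C, r, hC, hr, hr1, h⟩ := exists_norm_pow_le_of_spectralRadius_lt_one hradius
  refine ⟨C, r, hC, hr, hr1, fun n t => (norm_act_le _ t).trans ?_⟩
  rw [map_pow]
  gcongr
  exact h n

variable {A₀ A S : Matrix (Fin d) (Fin d) ℤ} {l q : Fin d → ℤ}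

theorem isExpansive_iff_charpoly :
    IsExpansive A ↔ ∀ β, (A.charpoly.map (Int.castRingHom ℂ)).IsRoot β → 1 < ‖β‖ := by
  refine forall_congr' fun β => ?_
  rw [Module.End.hasEigenvalue_iff_isRoot_charpoly, Matrix.charpoly_toLin', ← Matrix.charpoly_map]
  rfl

theorem IsExpansive.isContracting_inv (hA : IsExpansive A) (hdet : A.det ≠ 0) :
    IsContracting (toReal A)⁻¹ := by
  have hu : IsUnit (toReal A).det := (det_toReal_ne_zero hdet).isUnit
  let u : (Matrix (Fin d) (Fin d) ℂ)ˣ :=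
    ⟨Complex.ofRealHom.mapMatrix (toReal A), Complex.ofRealHom.mapMatrix (toReal A)⁻¹,
      by rw [← map_mul, Matrix.mul_nonsing_inv _ hu, map_one],
      by rw [← map_mul, Matrix.nonsing_inv_mul _ hu, map_one]⟩
  have hAu : Complex.ofRealHom.mapMatrix (toReal A) = A.map (fun a : ℤ => (a : ℂ)) := by
    ext i j; simp [toReal]
  refine isContracting_of_spectrum fun z hz => ?_
  have hz' : z⁻¹ ∈ spectrum ℂ (u : Matrix (Fin d) (Fin d) ℂ) := by
    rwa [← Set.mem_inv, spectrum.map_inv]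
  have hz0 : z ≠ 0 := spectrum.ne_zero_of_mem_of_unit (a := u⁻¹) hz
  have hlt := hA z⁻¹ <| by
    rw [Module.End.hasEigenvalue_iff_mem_spectrum, Matrix.spectrum_toLin', ← hAu]
    exact hz'
  rw [norm_inv] at hlt
  exact (one_lt_inv₀ (norm_pos_iff.mpr hz0)).mp hlt

theorem IsExpansive.transpose (hA : IsExpansive A) : IsExpansive Aᵀ := by
  rw [isExpansive_iff_charpoly] at hA ⊢
  rwa [Matrix.charpoly_transpose]

theorem IsExpansive.isContracting_transpose_inv (hA : IsExpansive A) (hdet : A.det ≠ 0) :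
    IsContracting (toReal A)ᵀ⁻¹ :=
  hA.transpose.isContracting_inv (by rwa [Matrix.det_transpose])

theorem PartitionData.charpoly_eq (hP : PartitionData A₀ A S l q) :
    A₀.charpoly = A.charpoly := by
  rw [hP.similar]
  exact Matrix.charpoly_units_conj' (S.nonsingInvUnit hP.isUnit_det_S) A

theorem PartitionData.det_eq (hP : PartitionData A₀ A S l q) : A₀.det = A.det := by
  rw [Matrix.det_eq_sign_charpoly_coeff, hP.charpoly_eq, ← Matrix.det_eq_sign_charpoly_coeff]

theorem PartitionData.isExpansive (hP : PartitionData A₀ A S l q) (hA : IsExpansive A₀) :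
    IsExpansive A := by
  rw [isExpansive_iff_charpoly] at hA ⊢
  rwa [← hP.charpoly_eq]

end Expansive

/-! ### Infinite products of a mask -/

/-- The infinite product `∏_{j ≥ 1} m (M^j s)`, the Fourier transform of the scaling function when
`m` is its mask. -/
def maskProd (M : Matrix (Fin d) (Fin d) ℝ) (m : Euc d → ℂ) (s : Euc d) : ℂ :=
  ∏' j : ℕ, m (act (M ^ (j + 1)) s)

section MaskProd

variable {M : Matrix (Fin d) (Fin d) ℝ} {m : Euc d → ℂ}

theorem exists_summable_norm_mask_sub_one_le (hM : IsContracting M)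
    (hm : (fun s => m s - 1) =O[⊤] fun s => s) :
    ∃ a : ℕ → ℝ, Summable a ∧ (∀ j, 0 ≤ a j) ∧
      ∀ s j, ‖m (act (M ^ (j + 1)) s) - 1‖ ≤ a j * ‖s‖ := by
  obtain ⟨C, r, hC, hr, hr1, hpow⟩ := hM
  obtain ⟨K, hK, hm⟩ := hm.exists_nonneg
  rw [Asymptotics.isBigOWith_top] at hm
  refine ⟨fun j => K * C * r * r ^ j, (summable_geometric_of_lt_one hr hr1).mul_left _,
    fun j => by positivity, fun s j => ?_⟩
  calc ‖m (act (M ^ (j + 1)) s) - 1‖ ≤ K * ‖act (M ^ (j + 1)) s‖ := hm _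
    _ ≤ K * (C * r ^ (j + 1) * ‖s‖) := by gcongr; exact hpow _ _
    _ = K * C * r * r ^ j * ‖s‖ := by ring

theorem multipliable_mask_act_pow (hM : IsContracting M)
    (hm : (fun s => m s - 1) =O[⊤] fun s => s) (s : Euc d) :
    Multipliable fun j : ℕ => m (act (M ^ (j + 1)) s) := by
  obtain ⟨a, ha, -, hle⟩ := exists_summable_norm_mask_sub_one_le hM hm
  simpa using multipliable_one_add_of_summable
    ((ha.mul_right ‖s‖).of_nonneg_of_le (fun _ => norm_nonneg _) (hle s))

theorem tendsto_prod_maskProd (hM : IsContracting M)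
    (hm : (fun s => m s - 1) =O[⊤] fun s => s) (s : Euc d) :
    Filter.Tendsto (fun J : ℕ => ∏ j ∈ Finset.range J, m (act (M ^ (j + 1)) s)) Filter.atTop
      (nhds (maskProd M m s)) :=
  (multipliable_mask_act_pow hM hm s).hasProd.tendsto_prod_nat

theorem exists_norm_maskProd_sub_one_le (hM : IsContracting M)
    (hm : (fun s => m s - 1) =O[⊤] fun s => s) :
    ∃ L : ℝ, ∀ s, ‖maskProd M m s - 1‖ ≤ Real.exp (L * ‖s‖) - 1 := by
  obtain ⟨a, ha, ha0, hle⟩ := exists_summable_norm_mask_sub_one_le hM hm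
  refine ⟨∑' j, a j, fun s => le_of_tendsto ((tendsto_prod_maskProd hM hm s).sub_const 1).norm
    (.of_forall fun J => ?_)⟩
  have hprod := Finset.norm_prod_one_add_sub_one_le (Finset.range J)
    fun j => m (act (M ^ (j + 1)) s) - 1
  simp only [add_sub_cancel] at hprod
  have hsum : ∑ j ∈ Finset.range J, ‖m (act (M ^ (j + 1)) s) - 1‖ ≤ (∑' j, a j) * ‖s‖ :=
    calc ∑ j ∈ Finset.range J, ‖m (act (M ^ (j + 1)) s) - 1‖
        ≤ ∑ j ∈ Finset.range J, a j * ‖s‖ := Finset.sum_le_sum fun j _ => hle s j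
      _ = (∑ j ∈ Finset.range J, a j) * ‖s‖ := (Finset.sum_mul ..).symm
      _ ≤ (∑' j, a j) * ‖s‖ := by gcongr; exact ha.sum_le_tsum _ fun j _ => ha0 j
  exact hprod.trans (by gcongr)

theorem tendsto_maskProd_nhds_zero (hM : IsContracting M)
    (hm : (fun s => m s - 1) =O[⊤] fun s => s) :
    Filter.Tendsto (maskProd M m) (nhds 0) (nhds 1) := by
  obtain ⟨L, hL⟩ := exists_norm_maskProd_sub_one_le hM hm
  rw [tendsto_iff_norm_sub_tendsto_zero]
  have hcont : Continuous fun s : Euc d => Real.exp (L * ‖s‖) - 1 := by fun_prop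
  exact squeeze_zero (fun _ => norm_nonneg _) hL (by simpa using hcont.tendsto 0)

theorem maskProd_eq_mul (hM : IsContracting M)
    (hm : (fun s => m s - 1) =O[⊤] fun s => s) (s : Euc d) :
    maskProd M m s = m (act M s) * maskProd M m (act M s) := by
  have hshift : (fun j : ℕ => m (act (M ^ (j + 1)) (act M s))) =
      fun j : ℕ => m (act (M ^ (j + 1 + 1)) s) := by
    ext j
    rw [act_mul, ← pow_succ]
  have hmul := multipliable_mask_act_pow hM hm (act M s)
  rw [hshift] at hmul
  rw [maskProd, tprod_eq_zero_mul' hmul, maskProd, hshift, zero_add, pow_one]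

theorem aestronglyMeasurable_maskProd (hM : IsContracting M)
    (hm : (fun s => m s - 1) =O[⊤] fun s => s) (hmc : Continuous m) :
    AEStronglyMeasurable (maskProd M m) (volume : Measure (Euc d)) :=
  aestronglyMeasurable_of_tendsto_ae Filter.atTop
    (f := fun J s => ∏ j ∈ Finset.range J, m (act (M ^ (j + 1)) s))
    (fun _ => (continuous_finsetProd _ fun _ _ =>
      hmc.comp (continuous_act _)).aestronglyMeasurable)
    (.of_forall fun s => tendsto_prod_maskProd hM hm s)

end MaskProd

/-- The mask `s ↦ m₀(2π s)` of a filter supported in `box d N`, where `m₀ = filterFun h`. The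
factor `2π` passes from the normalization of `filterFun` to that of Mathlib's Fourier transform. -/
def mask (N : ℕ) (h : (Fin d → ℤ) → ℂ) (s : Euc d) : ℂ :=
  (1 / Real.sqrt 2 : ℝ) * ∑ n ∈ box d N, h n * wave (intVec n) s

theorem continuous_mask (N : ℕ) (h : (Fin d → ℤ) → ℂ) : Continuous (mask N h) :=
  continuous_const.mul <| continuous_finsetSum _ fun _ _ => continuous_const.mul (continuous_wave _)

theorem norm_wave_sub_one_le (v s : Euc d) : ‖wave v s - 1‖ ≤ 2 * Real.pi * (‖v‖ * ‖s‖) := by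
  have hexp := Real.norm_exp_I_mul_ofReal_sub_one_le (x := -(2 * Real.pi * inner ℝ v s))
  rw [mul_comm Complex.I, ← wave_eq_exp, norm_neg, norm_mul,
    Real.norm_of_nonneg (by positivity)] at hexp
  exact hexp.trans (by gcongr; exact norm_inner_le_norm v s)

theorem inner_intVec (n : Fin d → ℤ) (t : Euc d) :
    inner ℝ (intVec n) t = ∑ i, (n i : ℝ) * t i := by
  simp [PiLp.inner_apply, intVec, mul_comm]

theorem det_smul_one_ne_zero {c : ℝ} (hc : c ≠ 0) :
    (c • (1 : Matrix (Fin d) (Fin d) ℝ)).det ≠ 0 := by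
  simp [hc]

theorem act_smul (M : Matrix (Fin d) (Fin d) ℝ) (c : ℝ) (t : Euc d) :
    act M (c • t) = c • act M t := by
  rw [act_eq_toEuclideanLin, map_smul]

theorem act_smul_one (c : ℝ) (t : Euc d) :
    act (c • (1 : Matrix (Fin d) (Fin d) ℝ)) t = c • t := by
  ext i
  simp [act, Matrix.smul_mulVec]

namespace IsFiniteLawtonSolution

variable {A : Matrix (Fin d) (Fin d) ℤ} {N : ℕ} {h : (Fin d → ℤ) → ℂ}

theorem finsum_eq_sum_box (hh : IsFiniteLawtonSolution A N h) {β : Type*} [AddCommMonoid β]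
    {F : (Fin d → ℤ) → β} (hF : ∀ n, h n = 0 → F n = 0) :
    ∑ᶠ n, F n = ∑ n ∈ box d N, F n :=
  finsum_eq_sum_of_support_subset _ fun n hn => by
    by_contra hnb
    exact hn (hF n (hh.finite n hnb))

theorem sum_box_eq (hh : IsFiniteLawtonSolution A N h) :
    ∑ n ∈ box d N, h n = (Real.sqrt 2 : ℂ) := by
  rw [← hh.finsum_eq_sum_box fun _ hn => hn, hh.normalization]

theorem filterFun_eq_mask (hh : IsFiniteLawtonSolution A N h) (t : Euc d) :
    filterFun h t = mask N h ((2 * Real.pi)⁻¹ • t) := by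
  rw [filterFun, mask, hh.finsum_eq_sum_box fun n hn => by rw [hn, zero_mul]]
  congr! 4 with n
  rw [wave_eq_exp, inner_smul_right, inner_intVec,
    mul_inv_cancel_left₀ (mul_ne_zero two_ne_zero Real.pi_ne_zero), Complex.ofReal_neg]
  ring_nf

theorem isBigO_mask_sub_one (hh : IsFiniteLawtonSolution A N h) :
    (fun s => mask N h s - 1) =O[⊤] fun s => s := by
  have hsub (s : Euc d) : mask N h s - 1 =
      (1 / Real.sqrt 2 : ℝ) * ∑ n ∈ box d N, h n * (wave (intVec n) s - 1) := by
    simp only [mask, mul_sub, mul_one, Finset.sum_sub_distrib, hh.sum_box_eq]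
    congr 1
    rw [← Complex.ofReal_mul, one_div_mul_cancel (by positivity), Complex.ofReal_one]
  simp only [hsub]
  refine .const_mul_left (.fun_sum fun n _ => .const_mul_left (.of_bound (2 * Real.pi * ‖intVec n‖)
    (.of_forall fun s => ?_)) _) _
  rw [mul_assoc]
  exact norm_wave_sub_one_le _ _

theorem factor_eq_mask (hh : IsFiniteLawtonSolution A N h) (ξ : Euc d) (j : ℕ) :
    factor A h ξ j = mask N h (act ((toReal A)ᵀ⁻¹ ^ (j + 1)) ((2 * Real.pi)⁻¹ • ξ)) := by
  rw [factor, hh.filterFun_eq_mask, act_smul]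

theorem multipliable_factor (hh : IsFiniteLawtonSolution A N h)
    (hA : IsContracting (toReal A)ᵀ⁻¹) (ξ : Euc d) : Multipliable (factor A h ξ) := by
  simpa only [← hh.factor_eq_mask] using
    multipliable_mask_act_pow hA hh.isBigO_mask_sub_one ((2 * Real.pi)⁻¹ • ξ)

theorem scalingFourier_eq_dilateFun (hh : IsFiniteLawtonSolution A N h) :
    scalingFourier A h = dilateFun ((2 * Real.pi)⁻¹ • (1 : Matrix (Fin d) (Fin d) ℝ))
      (maskProd (toReal A)ᵀ⁻¹ (mask N h)) := by
  have hpi : (0 : ℝ) < 2 * Real.pi := by positivity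
  have hconst : Real.sqrt |((2 * Real.pi)⁻¹ • (1 : Matrix (Fin d) (Fin d) ℝ)).det| =
      (2 * Real.pi) ^ (-(d : ℝ) / 2) := by
    rw [Matrix.det_smul, Matrix.det_one, mul_one, Fintype.card_fin,
      abs_of_nonneg (by positivity), Real.sqrt_eq_rpow, ← Real.rpow_natCast,
      Real.inv_rpow hpi.le, ← Real.rpow_neg hpi.le, ← Real.rpow_mul hpi.le]
    ring_nf
  ext ξ
  simp only [scalingFourier, dilateFun, hconst, maskProd, hh.factor_eq_mask, act_smul_one]

end IsFiniteLawtonSolution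

/-! ### Fourier series on the unit cube -/

section FourierSeries

attribute [local instance] instMeasureSpaceUnitAddCircle
  instIsProbabilityMeasureUnitAddCircleVolume

/-- The unit cube `(-1/2, 1/2]^d`, written so as to match `UnitAddTorus.measurableEquivPiIoc`. -/
def cube (d : ℕ) : Set (Euc d) := {s | ∀ i, s i ∈ Set.Ioc (-1 / 2 : ℝ) (-1 / 2 + 1)}

theorem measurableSet_cube : MeasurableSet (cube d) := by
  rw [show cube d = ⋂ i, (fun s : Euc d => s i) ⁻¹' Set.Ioc (-1 / 2 : ℝ) (-1 / 2 + 1) by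
    ext s; simp [cube]]
  exact .iInter fun i => measurableSet_Ioc.preimage (by fun_prop)

theorem ball_subset_cube : Metric.ball (0 : Euc d) (1 / 2) ⊆ cube d := by
  intro s hs i
  have hsi := (PiLp.norm_apply_le s i).trans_lt (mem_ball_zero_iff.mp hs)
  rw [Real.norm_eq_abs, abs_lt] at hsi
  constructor <;> linarith [hsi.1, hsi.2]

/-- The representative in the cube of a point of the torus. -/
def torusLift (x : UnitAddTorus (Fin d)) : Euc d :=
  WithLp.toLp 2 (UnitAddTorus.measurableEquivPiIoc (fun _ => -1 / 2) x).1

theorem measurableSet_pi_Ioc :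
    MeasurableSet {x : Fin d → ℝ | ∀ i, x i ∈ Set.Ioc (-1 / 2 : ℝ) (-1 / 2 + 1)} :=
  MeasurableSet.univ_pi' fun _ => measurableSet_Ioc

theorem measurableEmbedding_torusLift :
    MeasurableEmbedding (torusLift : UnitAddTorus (Fin d) → Euc d) :=
  (MeasurableEquiv.toLp 2 (Fin d → ℝ)).measurableEmbedding.comp <|
    (MeasurableEmbedding.subtype_coe measurableSet_pi_Ioc).comp
      (UnitAddTorus.measurableEquivPiIoc _).measurableEmbedding

theorem measurePreserving_torusLift :
    MeasurePreserving (torusLift : UnitAddTorus (Fin d) → Euc d) volume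
      (volume.restrict (cube d)) := by
  have hcoe : MeasurePreserving
      (Subtype.val : {x : Fin d → ℝ // ∀ i, x i ∈ Set.Ioc (-1 / 2 : ℝ) (-1 / 2 + 1)} → Fin d → ℝ)
      (Measure.comap Subtype.val volume)
      (volume.restrict {x : Fin d → ℝ | ∀ i, x i ∈ Set.Ioc (-1 / 2 : ℝ) (-1 / 2 + 1)}) :=
    ⟨measurable_subtype_coe, map_comap_subtype_coe measurableSet_pi_Ioc volume⟩
  exact ((PiLp.volume_preserving_toLp (Fin d)).restrict_preimage measurableSet_cube).comp <|
    hcoe.comp (UnitAddTorus.measurePreserving_equivPiIoc fun _ => -1 / 2)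

theorem coe_torusLift (x : UnitAddTorus (Fin d)) (i : Fin d) :
    ((torusLift x i : ℝ) : UnitAddCircle) = x i :=
  AddCircle.coe_equivIoc

theorem mFourier_neg_eq_wave (n : Fin d → ℤ) (x : UnitAddTorus (Fin d)) :
    UnitAddTorus.mFourier (-n) x = wave (intVec n) (torusLift x) := by
  have hfactor (i : Fin d) : fourier ((-n) i) (x i) =
      Complex.exp ((-(2 * Real.pi * (n i * torusLift x i)) : ℝ) * Complex.I) := by
    rw [← coe_torusLift x i, fourier_coe_apply]
    congr 1
    push_cast [Pi.neg_apply]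
    ring
  change ∏ i, fourier ((-n) i) (x i) = _
  rw [Finset.prod_congr rfl fun i _ => hfactor i, ← Complex.exp_sum, wave_eq_exp, ← Finset.sum_mul,
    ← Complex.ofReal_sum, Finset.sum_neg_distrib, ← Finset.mul_sum, inner_intVec]

theorem integral_torusLift {E : Type*} [NormedAddCommGroup E] [NormedSpace ℝ E] (f : Euc d → E) :
    ∫ x : UnitAddTorus (Fin d), f (torusLift x) = ∫ s in cube d, f s :=
  measurePreserving_torusLift.integral_comp measurableEmbedding_torusLift f

theorem volume_cube_lt_top : volume (cube d) < ⊤ := by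
  have h := (measurePreserving_torusLift (d := d)).measure_preimage
    (s := Set.univ) MeasurableSet.univ.nullMeasurableSet
  rw [Measure.restrict_apply_univ, Set.preimage_univ] at h
  exact h ▸ measure_lt_top _ _

theorem hasSum_sq_norm_integral_wave_mul {f : Euc d → ℂ} (hf : MemLp f 2 volume)
    (hfc : ∀ᵐ s, s ∉ cube d → f s = 0) :
    HasSum (fun n : Fin d → ℤ => ‖∫ s, wave (intVec n) s * f s‖ ^ 2) (∫ s, ‖f s‖ ^ 2) := by
  have hg : MemLp (fun x => f (torusLift x)) 2 (volume : Measure (UnitAddTorus (Fin d))) :=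
    (hf.restrict (cube d)).comp_measurePreserving measurePreserving_torusLift
  have integral_eq {E : Type} [NormedAddCommGroup E] [NormedSpace ℝ E] {G : Euc d → E}
      (hG : ∀ s, f s = 0 → G s = 0) :
      ∫ s, G s = ∫ x : UnitAddTorus (Fin d), G (torusLift x) := by
    rw [integral_torusLift, setIntegral_eq_integral_of_ae_compl_eq_zero]
    filter_upwards [hfc] with s hs hsc using hG s (hs hsc)
  have hnorm : ∫ s, ‖f s‖ ^ 2 = ∫ x, ‖hg.toLp _ x‖ ^ 2 := by
    rw [integral_eq fun s hs => by simp [hs]]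
    refine integral_congr_ae ?_
    filter_upwards [hg.coeFn_toLp] with x hx
    rw [hx]
  rw [hnorm]
  refine (UnitAddTorus.hasSum_sq_mFourierCoeff (hg.toLp _)).congr_fun fun n => ?_
  rw [integral_eq fun s hs => by rw [hs, mul_zero], UnitAddTorus.mFourierCoeff]
  congr 2
  refine integral_congr_ae ?_
  filter_upwards [hg.coeFn_toLp] with x hx
  rw [hx, mFourier_neg_eq_wave, smul_eq_mul]

theorem integral_cube_wave (n : Fin d → ℤ) :
    ∫ s in cube d, wave (intVec n) s = if n = 0 then 1 else 0 := by
  rw [← integral_torusLift,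
    ← orthonormal_iff_ite.mp (UnitAddTorus.orthonormal_mFourier (d := Fin d)) n 0,
    ← UnitAddTorus.coe_mFourierBasis, ← HilbertBasis.repr_apply_apply,
    UnitAddTorus.mFourierBasis_repr, UnitAddTorus.coe_mFourierBasis,
    UnitAddTorus.mFourierCoeff_toLp, UnitAddTorus.mFourierCoeff]
  simp [mFourier_neg_eq_wave, UnitAddTorus.mFourier_zero]

/-- The indicator function of the unit cube: the Fourier transform of the function that starts the
cascade algorithm. -/
def cubeIndicator (d : ℕ) : L2 d :=
  indicatorConstLp 2 measurableSet_cube volume_cube_lt_top.ne (1 : ℂ)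

theorem coeFn_cubeIndicator :
    (cubeIndicator d : Euc d → ℂ) =ᵐ[volume] (cube d).indicator fun _ => 1 :=
  indicatorConstLp_coeFn

theorem inner_translation_translation (v w : Euc d) (f g : L2 d) :
    inner ℂ (translation v f) (translation w g) =
      ∫ s, wave (w - v) s * (inner ℂ (FT d f s) (FT d g s) : ℂ) := by
  rw [← (FT d).inner_map_map, FT_translation, FT_translation, L2.inner_def]
  refine integral_congr_ae ?_
  filter_upwards [coeFn_modulation v (FT d f), coeFn_modulation w (FT d g)] with s hv hw
  rw [hv, hw, RCLike.inner_apply, RCLike.inner_apply, map_mul, conj_wave, sub_eq_add_neg,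
    wave_add_left]
  ring

theorem orthonormal_translation_cubeIndicator :
    Orthonormal ℂ fun k : Fin d → ℤ => translation (intVec k) ((FT d).symm (cubeIndicator d)) := by
  rw [orthonormal_iff_ite]
  intro k l
  have hindicator : ∀ᵐ s, wave (intVec l - intVec k) s *
      (inner ℂ (cubeIndicator d s) (cubeIndicator d s) : ℂ) =
      (cube d).indicator (wave (intVec (l - k))) s := by
    filter_upwards [coeFn_cubeIndicator (d := d)] with s hs
    rw [hs, sub_eq_add_neg l, intVec_add, intVec_neg, ← sub_eq_add_neg]
    by_cases hsc : s ∈ cube d <;> simp [hsc]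
  rw [inner_translation_translation, LinearIsometryEquiv.apply_symm_apply,
    integral_congr_ae hindicator, integral_indicator measurableSet_cube, integral_cube_wave]
  simp only [sub_eq_zero, eq_comm]

end FourierSeries

/-! ### The cascade algorithm -/

section Bessel

variable {ι E : Type*} [NormedAddCommGroup E] [InnerProductSpace ℂ E] {e : ι → E}

/-- The family `e` is a Bessel sequence with bound `1`. -/
def IsBessel (e : ι → E) : Prop :=
  ∀ (f : E) (F : Finset ι), ∑ k ∈ F, ‖(inner ℂ (e k) f : ℂ)‖ ^ 2 ≤ ‖f‖ ^ 2

theorem isBessel_of_norm_sum_smul_sq_le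
    (he : ∀ (c : ι → ℂ) (F : Finset ι), ‖∑ k ∈ F, c k • e k‖ ^ 2 ≤ ∑ k ∈ F, ‖c k‖ ^ 2) :
    IsBessel e := by
  intro f F
  have hinner : (inner ℂ f (∑ k ∈ F, (inner ℂ (e k) f : ℂ) • e k) : ℂ).re =
      ∑ k ∈ F, ‖(inner ℂ (e k) f : ℂ)‖ ^ 2 := by
    rw [inner_sum, Complex.re_sum]
    refine Finset.sum_congr rfl fun k _ => ?_
    rw [inner_smul_right, ← inner_conj_symm f, Complex.mul_conj, Complex.ofReal_re,
      Complex.normSq_eq_norm_sq]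
  have hnonneg := sq_nonneg ‖f - ∑ k ∈ F, (inner ℂ (e k) f : ℂ) • e k‖
  rw [@norm_sub_sq ℂ, RCLike.re_eq_complex_re, hinner] at hnonneg
  linarith [he (fun k => inner ℂ (e k) f) F]

theorem norm_sum_smul_sq_of_orthonormal (he : Orthonormal ℂ e) (c : ι → ℂ) (F : Finset ι) :
    ‖∑ k ∈ F, c k • e k‖ ^ 2 = ∑ k ∈ F, ‖c k‖ ^ 2 := by
  simpa using he.orthogonalFamily.norm_sum c F

end Bessel

section Cascade

variable {A : Matrix (Fin d) (Fin d) ℤ} {N : ℕ} {h : (Fin d → ℤ) → ℂ} {x φ : L2 d}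

/-- The refinement operator `x ↦ ∑_n h_n D_A T_n x`, whose fixed points are the solutions of the
refinement equation. -/
def refinement (A : Matrix (Fin d) (Fin d) ℤ) (N : ℕ) (h : (Fin d → ℤ) → ℂ) (x : L2 d) : L2 d :=
  ∑ n ∈ box d N, h n • dilation (toReal A) (translation (intVec n) x)

theorem FT_sum_translation {ι : Type*} (s : Finset ι) (c : ι → ℂ) (v : ι → Euc d) (x : L2 d) :
    FT d (∑ i ∈ s, c i • translation (v i) x) = ∑ i ∈ s, c i • modulation (v i) (FT d x) := by
  simp only [map_sum, map_smul, FT_translation]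

theorem coeFn_FT_sum_translation {ι : Type*} (s : Finset ι) (c : ι → ℂ) (v : ι → Euc d) (x : L2 d) :
    FT d (∑ i ∈ s, c i • translation (v i) x) =ᵐ[volume]
      fun t => (∑ i ∈ s, c i * wave (v i) t) * FT d x t := by
  have hterm : ∀ᵐ t, ∀ i ∈ s,
      (c i • modulation (v i) (FT d x) : L2 d) t = c i * wave (v i) t * FT d x t :=
    (Finset.eventually_all s).mpr fun i _ => by
      filter_upwards [Lp.coeFn_smul (c i) (modulation (v i) (FT d x)),
        coeFn_modulation (v i) (FT d x)] with t hsmul hmod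
      rw [hsmul, Pi.smul_apply, hmod, smul_eq_mul, mul_assoc]
  rw [FT_sum_translation]
  filter_upwards [Lp.coeFn_fun_finsetSum s fun i => c i • modulation (v i) (FT d x), hterm]
    with t hsum hterm
  rw [hsum, Finset.sum_mul, Finset.sum_congr rfl hterm]

theorem det_ne_zero_of_natAbs_eq_two (hA : A.det.natAbs = 2) : A.det ≠ 0 := by
  lia

theorem abs_det_toReal (hA : A.det.natAbs = 2) : |(toReal A).det| = 2 := by
  rw [det_toReal, ← Int.cast_abs, Int.abs_eq_natAbs, hA]
  norm_num

theorem refinement_eq_dilation_sum (x : L2 d) :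
    refinement A N h x = dilation (toReal A) (∑ n ∈ box d N, h n • translation (intVec n) x) := by
  simp only [refinement, map_sum, map_smul]

theorem coeFn_FT_refinement (hA : A.det.natAbs = 2) (x : L2 d) :
    FT d (refinement A N h x) =ᵐ[volume] fun s =>
      mask N h (act (toReal A)ᵀ⁻¹ s) * FT d x (act (toReal A)ᵀ⁻¹ s) := by
  have hdet := det_toReal_ne_zero (det_ne_zero_of_natAbs_eq_two hA)
  have hdet' := det_transpose_inv_ne_zero hdet
  rw [refinement_eq_dilation_sum, FT_dilation hdet]
  filter_upwards [coeFn_dilation hdet' (FT d (∑ n ∈ box d N, h n • translation (intVec n) x)),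
    (quasiMeasurePreserving_act hdet').ae (coeFn_FT_sum_translation (box d N) h intVec x)]
    with s hdil hsum
  rw [hdil, hsum, mask, ← mul_assoc, Matrix.det_nonsing_inv, Matrix.det_transpose,
    Ring.inverse_eq_inv', abs_inv, abs_det_toReal hA, Real.sqrt_inv, one_div]

theorem translation_sum_dilation (hdet : A.det ≠ 0) (s : Finset (Fin d → ℤ))
    (c : (Fin d → ℤ) → ℂ) (k : Fin d → ℤ) (x : L2 d) :
    translation (intVec k) (∑ n ∈ s, c n • dilation (toReal A) (translation (intVec n) x)) =
      ∑ n ∈ s, c n • dilation (toReal A) (translation (intVec (A *ᵥ k + n)) x) := by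
  simp only [map_sum, map_smul, translation_dilation (det_toReal_ne_zero hdet), act_intVec,
    translation_add, ← intVec_add]

theorem IsFiniteLawtonSolution.sum_mul_conj (hh : IsFiniteLawtonSolution A N h) {k : Fin d → ℤ}
    (hk : k ∈ lattice A) :
    ∑ n ∈ box d N, h n * (starRingEnd ℂ) (h (n + k)) = if k = 0 then 1 else 0 := by
  rw [← hh.orthogonality k hk, hh.finsum_eq_sum_box fun n hn => by rw [hn, zero_mul]]

theorem IsFiniteLawtonSolution.orthonormal_refinement (hh : IsFiniteLawtonSolution A N h)
    (hdet : A.det ≠ 0) (hx : Orthonormal ℂ fun k : Fin d → ℤ => translation (intVec k) x) :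
    Orthonormal ℂ fun k : Fin d → ℤ => translation (intVec k) (refinement A N h x) := by
  rw [orthonormal_iff_ite] at hx ⊢
  intro k l
  have hindex (m n : Fin d → ℤ) : A *ᵥ k + n = A *ᵥ l + m ↔ m = n + A *ᵥ (k - l) := by
    rw [Matrix.mulVec_sub, ← add_right_inj (A *ᵥ l) (b := m), eq_comm]
    abel_nf
  have hterm : ∀ n ∈ box d N, (inner ℂ
      (h n • dilation (toReal A) (translation (intVec (A *ᵥ k + n)) x))
      (∑ m ∈ box d N, h m • dilation (toReal A) (translation (intVec (A *ᵥ l + m)) x)) : ℂ) =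
      (starRingEnd ℂ) (h n * (starRingEnd ℂ) (h (n + A *ᵥ (k - l)))) := by
    intro n _
    simp only [inner_sum, inner_smul_left, inner_smul_right, LinearIsometryEquiv.inner_map_map, hx,
      hindex, mul_ite, mul_one, mul_zero, Finset.sum_ite_eq']
    split_ifs with hn
    · rw [map_mul, Complex.conj_conj, mul_comm]
    · rw [hh.finite _ hn, map_zero, mul_zero, map_zero]
  have hzero : A *ᵥ (k - l) = 0 ↔ k = l :=
    ⟨fun h0 => sub_eq_zero.mp (Matrix.eq_zero_of_mulVec_eq_zero hdet h0),
      fun hkl => by rw [hkl, sub_self, Matrix.mulVec_zero]⟩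
  rw [refinement, translation_sum_dilation hdet, translation_sum_dilation hdet, sum_inner,
    Finset.sum_congr rfl hterm, ← map_sum, hh.sum_mul_conj ⟨k - l, rfl⟩]
  simp only [hzero]
  split_ifs <;> simp

/-- The cascade algorithm, started from the inverse Fourier transform of the unit cube. -/
def cascade (A : Matrix (Fin d) (Fin d) ℤ) (N : ℕ) (h : (Fin d → ℤ) → ℂ) : ℕ → L2 d
  | 0 => (FT d).symm (cubeIndicator d)
  | J + 1 => refinement A N h (cascade A N h J)

theorem IsFiniteLawtonSolution.orthonormal_cascade (hh : IsFiniteLawtonSolution A N h)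
    (hdet : A.det ≠ 0) (J : ℕ) :
    Orthonormal ℂ fun k : Fin d → ℤ => translation (intVec k) (cascade A N h J) := by
  induction J with
  | zero => exact orthonormal_translation_cubeIndicator
  | succ J ih => exact hh.orthonormal_refinement hdet ih

theorem coeFn_FT_cascade (hA : A.det.natAbs = 2) (J : ℕ) :
    FT d (cascade A N h J) =ᵐ[volume] fun s =>
      (∏ j ∈ Finset.range J, mask N h (act ((toReal A)ᵀ⁻¹ ^ (j + 1)) s)) *
        (cube d).indicator (fun _ => 1) (act ((toReal A)ᵀ⁻¹ ^ J) s) := by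
  induction J with
  | zero =>
    rw [cascade, LinearIsometryEquiv.apply_symm_apply]
    filter_upwards [coeFn_cubeIndicator (d := d)] with s hs
    simp [hs, act_one]
  | succ J ih =>
    have hdet := det_transpose_inv_ne_zero (det_toReal_ne_zero (det_ne_zero_of_natAbs_eq_two hA))
    filter_upwards [coeFn_FT_refinement hA (cascade A N h J),
      (quasiMeasurePreserving_act hdet).ae ih] with s hstep hprev
    rw [cascade, hstep, hprev, Finset.prod_range_succ']
    simp only [act_mul, ← pow_succ, zero_add, pow_one]
    ring

theorem tendsto_act_pow {M : Matrix (Fin d) (Fin d) ℝ} (hM : IsContracting M) (s : Euc d) :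
    Filter.Tendsto (fun n : ℕ => act (M ^ n) s) Filter.atTop (nhds 0) := by
  obtain ⟨C, r, -, hr, hr1, hpow⟩ := hM
  refine squeeze_zero_norm (hpow · s) ?_
  simpa using ((tendsto_pow_atTop_nhds_zero_of_lt_one hr hr1).const_mul C).mul_const ‖s‖

theorem IsFiniteLawtonSolution.tendsto_FT_cascade (hh : IsFiniteLawtonSolution A N h)
    (hA : A.det.natAbs = 2) (hc : IsContracting (toReal A)ᵀ⁻¹) :
    ∀ᵐ s, Filter.Tendsto (fun J => FT d (cascade A N h J) s) Filter.atTop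
      (nhds (maskProd (toReal A)ᵀ⁻¹ (mask N h) s)) := by
  filter_upwards [ae_all_iff.mpr fun J => coeFn_FT_cascade (N := N) (h := h) hA J] with s hs
  have hcube : Filter.Tendsto (fun J => (cube d).indicator (fun _ => (1 : ℂ))
      (act ((toReal A)ᵀ⁻¹ ^ J) s)) Filter.atTop (nhds 1) := by
    refine tendsto_const_nhds.congr' ?_
    filter_upwards [(tendsto_act_pow hc s).eventually
      (Metric.ball_mem_nhds (0 : Euc d) (half_pos one_pos))] with J hJ
    rw [Set.indicator_of_mem (ball_subset_cube hJ)]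
  simpa only [hs, mul_one] using (tendsto_prod_maskProd hc hh.isBigO_mask_sub_one s).mul hcube

-- The translates of each cascade iterate are orthonormal; Fatou's lemma passes the resulting norm
-- identity to the limit, where only an inequality survives.
theorem IsFiniteLawtonSolution.eLpNorm_sum_wave_mul_maskProd_le (hh : IsFiniteLawtonSolution A N h)
    (hA : A.det.natAbs = 2) (hc : IsContracting (toReal A)ᵀ⁻¹)
    (F : Finset (Fin d → ℤ)) (c : (Fin d → ℤ) → ℂ) :
    eLpNorm (fun s => (∑ k ∈ F, c k * wave (intVec k) s) *
        maskProd (toReal A)ᵀ⁻¹ (mask N h) s) 2 volume ≤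
      ENNReal.ofReal (Real.sqrt (∑ k ∈ F, ‖c k‖ ^ 2)) := by
  let y (J : ℕ) : L2 d := ∑ k ∈ F, c k • translation (intVec k) (cascade A N h J)
  have hnorm (J : ℕ) : eLpNorm (FT d (y J)) 2 volume =
      ENNReal.ofReal (Real.sqrt (∑ k ∈ F, ‖c k‖ ^ 2)) := by
    rw [← norm_sum_smul_sq_of_orthonormal
      (hh.orthonormal_cascade (det_ne_zero_of_natAbs_eq_two hA) J), Real.sqrt_sq (norm_nonneg _),
      ← (FT d).norm_map, Lp.norm_def, ENNReal.ofReal_toReal (Lp.eLpNorm_ne_top _)]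
  have hlim : ∀ᵐ s, Filter.Tendsto (fun J => FT d (y J) s) Filter.atTop (nhds
      ((∑ k ∈ F, c k * wave (intVec k) s) * maskProd (toReal A)ᵀ⁻¹ (mask N h) s)) := by
    filter_upwards [hh.tendsto_FT_cascade hA hc, ae_all_iff.mpr fun J =>
      coeFn_FT_sum_translation F c intVec (cascade A N h J)] with s hs hy
    simpa only [y, hy] using hs.const_mul _
  refine (Lp.eLpNorm_lim_le_liminf_eLpNorm (fun J => Lp.aestronglyMeasurable (FT d (y J))) _
    hlim).trans_eq ?_
  simp only [hnorm, Filter.liminf_const]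

theorem IsFiniteLawtonSolution.memLp_maskProd (hh : IsFiniteLawtonSolution A N h)
    (hA : A.det.natAbs = 2) (hc : IsContracting (toReal A)ᵀ⁻¹) :
    MemLp (maskProd (toReal A)ᵀ⁻¹ (mask N h)) 2 volume := by
  refine ⟨aestronglyMeasurable_maskProd hc hh.isBigO_mask_sub_one (continuous_mask N h), ?_⟩
  have hle := hh.eLpNorm_sum_wave_mul_maskProd_le hA hc {0} fun _ => 1
  simp only [Finset.sum_singleton, intVec_zero, wave_zero_left, one_mul] at hle
  exact hle.trans_lt ENNReal.ofReal_lt_top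

/-! ### The scaling function -/

theorem IsFiniteLawtonSolution.eq_refinement (hh : IsFiniteLawtonSolution A N h)
    (hA : A.det.natAbs = 2) (hc : IsContracting (toReal A)ᵀ⁻¹)
    (hφ : FT d φ =ᵐ[volume] maskProd (toReal A)ᵀ⁻¹ (mask N h)) : φ = refinement A N h φ := by
  have hdet := det_transpose_inv_ne_zero (det_toReal_ne_zero (det_ne_zero_of_natAbs_eq_two hA))
  refine (FT d).injective (Lp.ext ?_)
  filter_upwards [coeFn_FT_refinement (N := N) (h := h) hA φ, hφ,
    (quasiMeasurePreserving_act hdet).ae hφ] with s href hs hs'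
  rw [href, hs, hs', maskProd_eq_mul hc hh.isBigO_mask_sub_one]

theorem IsFiniteLawtonSolution.isBessel_translation (hh : IsFiniteLawtonSolution A N h)
    (hA : A.det.natAbs = 2) (hc : IsContracting (toReal A)ᵀ⁻¹)
    (hφ : FT d φ =ᵐ[volume] maskProd (toReal A)ᵀ⁻¹ (mask N h)) :
    IsBessel fun k : Fin d → ℤ => translation (intVec k) φ := by
  refine isBessel_of_norm_sum_smul_sq_le fun c F => ?_
  rw [← Real.le_sqrt (norm_nonneg _) (by positivity), ← (FT d).norm_map, Lp.norm_def]
  refine ENNReal.toReal_le_of_le_ofReal (Real.sqrt_nonneg _)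
    ((eLpNorm_congr_ae ?_).trans_le (hh.eLpNorm_sum_wave_mul_maskProd_le hA hc F c))
  filter_upwards [coeFn_FT_sum_translation F c intVec φ, hφ] with s hsum hs
  rw [hsum, hs]

theorem IsFiniteLawtonSolution.memLp_scalingFourier (hh : IsFiniteLawtonSolution A N h)
    (hA : A.det.natAbs = 2) (hc : IsContracting (toReal A)ᵀ⁻¹) :
    MemLp (scalingFourier A h) 2 (volume : Measure (Euc d)) := by
  rw [hh.scalingFourier_eq_dilateFun]
  exact memLp_dilateFun (det_smul_one_ne_zero (by positivity)) (hh.memLp_maskProd hA hc)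

theorem IsFiniteLawtonSolution.coeFn_FT_scaling (hh : IsFiniteLawtonSolution A N h)
    (hA : A.det.natAbs = 2) (hc : IsContracting (toReal A)ᵀ⁻¹)
    (hg : MemLp (scalingFourier A h) 2 (volume : Measure (Euc d))) :
    FT d (scaling A h hg) =ᵐ[volume] maskProd (toReal A)ᵀ⁻¹ (mask N h) := by
  have hG := hh.memLp_maskProd hA hc
  have hscale : ((2 * Real.pi)⁻¹ • (1 : Matrix (Fin d) (Fin d) ℝ)).det ≠ 0 :=
    det_smul_one_ne_zero (by positivity)
  have hdil : hg.toLp (scalingFourier A h) =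
      dilation ((2 * Real.pi)⁻¹ • (1 : Matrix (Fin d) (Fin d) ℝ)) (hG.toLp _) := by
    refine Lp.ext ?_
    filter_upwards [coeFn_dilation hscale (hG.toLp _), dilateFun_congr hscale hG.coeFn_toLp,
      hg.coeFn_toLp] with s hs hcongr hg
    rw [hg, hs, hh.scalingFourier_eq_dilateFun, ← hcongr]
    rfl
  have hFT : FT d (scaling A h hg) = hG.toLp _ := by
    rw [scaling, hdil]
    change FT d ((FT d).symm ((dilation _).symm (dilation _ (hG.toLp _)))) = _
    rw [LinearIsometryEquiv.symm_apply_apply, LinearIsometryEquiv.apply_symm_apply]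
  exact hFT ▸ hG.coeFn_toLp

end Cascade

/-! ### The analysis operator -/

section L2Norm

variable {α E : Type*} [MeasurableSpace α] {μ : Measure α} [NormedAddCommGroup E]

theorem enorm_sq_eq_lintegral (f : Lp E 2 μ) : ‖f‖ₑ ^ 2 = ∫⁻ t, ‖f t‖ₑ ^ 2 ∂μ := by
  simpa [Lp.enorm_def] using
    eLpNorm_nnreal_pow_eq_lintegral (f := f) (μ := μ) (p := 2) two_ne_zero

theorem norm_sq_eq_integral (f : Lp E 2 μ) : ‖f‖ ^ 2 = ∫ t, ‖f t‖ ^ 2 ∂μ := by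
  rw [integral_eq_lintegral_of_nonneg_ae (Filter.Eventually.of_forall fun t => sq_nonneg _)
    ((Lp.aestronglyMeasurable f).norm.pow 2)]
  simp only [ENNReal.ofReal_pow (norm_nonneg _), ofReal_norm, ← enorm_sq_eq_lintegral,
    ENNReal.toReal_pow, toReal_enorm]

end L2Norm

section Analysis

variable {ι E : Type*} [NormedAddCommGroup E] [InnerProductSpace ℂ E] {e : ι → E}

/-- The analysis operator `f ↦ (⟨e k, f⟩)_k` of a Bessel sequence. -/
def analysis (he : IsBessel e) : E →ₗ[ℂ] lp (fun _ : ι => ℂ) 2 where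
  toFun f := ⟨fun k => inner ℂ (e k) f, memℓp_gen' (C := ‖f‖ ^ 2) fun F => by simpa using he f F⟩
  map_add' f g := by ext k; exact inner_add_right _ _ _
  map_smul' c f := by ext k; exact inner_smul_right _ _ _

variable (he : IsBessel e)

theorem analysis_apply (f : E) (k : ι) : analysis he f k = inner ℂ (e k) f := rfl

theorem norm_analysis_le_of_sum_le {f : E} {C : ℝ} (hC : 0 ≤ C)
    (h : ∀ F : Finset ι, ∑ k ∈ F, ‖(inner ℂ (e k) f : ℂ)‖ ^ 2 ≤ C ^ 2) : ‖analysis he f‖ ≤ C :=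
  lp.norm_le_of_forall_sum_le (by simp) hC fun F => by simpa [analysis_apply] using h F

theorem norm_analysis_le (f : E) : ‖analysis he f‖ ≤ ‖f‖ :=
  norm_analysis_le_of_sum_le he (norm_nonneg f) (he f)

theorem hasSum_sq_analysis (f : E) :
    HasSum (fun k => ‖(inner ℂ (e k) f : ℂ)‖ ^ 2) (‖analysis he f‖ ^ 2) := by
  simpa [analysis_apply] using lp.hasSum_norm (p := 2) (by simp) (analysis he f)

theorem lipschitzWith_norm_analysis (u : E ≃ₗᵢ[ℂ] E) :
    LipschitzWith 1 fun f => ‖analysis he (u f)‖ :=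
  LipschitzWith.of_dist_le_mul fun f g => by
    rw [NNReal.coe_one, one_mul, dist_eq_norm f g, ← u.norm_map, map_sub]
    exact (abs_norm_sub_norm_le _ _).trans (by rw [← map_sub]; exact norm_analysis_le he _)

theorem tendsto_norm_analysis_of_dense (u : ℕ → E ≃ₗᵢ[ℂ] E) {c : ℝ} {s : Set E} (hs : Dense s)
    (h : ∀ g ∈ s, Filter.Tendsto (fun n => ‖analysis he (u n g)‖) Filter.atTop (nhds (c * ‖g‖)))
    (f : E) : Filter.Tendsto (fun n => ‖analysis he (u n f)‖) Filter.atTop (nhds (c * ‖f‖)) := by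
  have hequi : Equicontinuous fun (n : ℕ) (f : E) => ‖analysis he (u n f)‖ :=
    (LipschitzWith.uniformEquicontinuous _ 1 fun n =>
      lipschitzWith_norm_analysis he (u n)).equicontinuous
  exact closure_minimal h (hequi.isClosed_setOfPred_tendsto (continuous_const.mul continuous_norm))
    (hs f)

end Analysis

theorem dense_setOf_bounded_support :
    Dense {g : L2 d | ∃ R, ∀ᵐ t, R ≤ ‖t‖ → g t = 0} := by
  refine Metric.dense_iff.mpr fun f ε hε => ?_
  obtain ⟨g, hcompact, hle, -, hgm⟩ := (Lp.memLp f).exists_hasCompactSupport_eLpNorm_sub_le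
    ENNReal.ofNat_ne_top (ε := ENNReal.ofReal (ε / 2)) (by simpa using hε)
  obtain ⟨R, hR⟩ := hcompact.isCompact.isBounded.subset_ball 0
  refine ⟨hgm.toLp g, ?_, R, ?_⟩
  · rw [Metric.mem_ball, dist_comm, Lp.dist_def]
    refine (ENNReal.toReal_le_of_le_ofReal (half_pos hε).le
      ((eLpNorm_congr_ae ?_).trans_le hle)).trans_lt (half_lt_self hε)
    filter_upwards [hgm.coeFn_toLp] with t ht
    rw [Pi.sub_apply, Pi.sub_apply, ht]
  · filter_upwards [hgm.coeFn_toLp] with t ht hRt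
    rw [ht]
    by_contra hne
    exact hRt.not_gt (mem_ball_zero_iff.mp (hR (subset_tsupport g hne)))

theorem dense_setOf_bounded_spectrum :
    Dense {g : L2 d | ∃ R, ∀ᵐ s, R ≤ ‖s‖ → FT d g s = 0} :=
  dense_setOf_bounded_support.preimage (FT d).toHomeomorph.isOpenMap

theorem dilation_eq_zero_of_le_norm {M : Matrix (Fin d) (Fin d) ℝ} (hM : M.det ≠ 0) {R δ : ℝ}
    (hshrink : ∀ t, ‖t‖ < R → ‖act M⁻¹ t‖ < δ) {f : L2 d} (hf : ∀ᵐ t, R ≤ ‖t‖ → f t = 0) :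
    ∀ᵐ t, δ ≤ ‖t‖ → dilation M f t = 0 := by
  filter_upwards [coeFn_dilation hM f, (quasiMeasurePreserving_act hM).ae hf] with t hdil hf hδt
  rw [hdil, hf, mul_zero]
  by_contra! hlt
  exact hδt.not_gt (act_inv_act hM t ▸ hshrink _ hlt)

theorem IsContracting.eventually_norm_act_pow_lt {M : Matrix (Fin d) (Fin d) ℝ}
    (hM : IsContracting M) (R : ℝ) {δ : ℝ} (hδ : 0 < δ) :
    ∀ᶠ n : ℕ in Filter.atTop, ∀ t, ‖t‖ < R → ‖act (M ^ n) t‖ < δ := by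
  obtain ⟨C, r, hC, hr, hr1, hpow⟩ := hM
  have hlim : Filter.Tendsto (fun n : ℕ => C * r ^ n * R) Filter.atTop (nhds 0) := by
    simpa using ((tendsto_pow_atTop_nhds_zero_of_lt_one hr hr1).const_mul C).mul_const R
  filter_upwards [hlim.eventually_lt_const hδ] with n hn t ht
  calc ‖act (M ^ n) t‖ ≤ C * r ^ n * ‖t‖ := hpow n t
    _ ≤ C * r ^ n * R := by gcongr
    _ < δ := hn

/-! ### High resolution -/

section HighResolution

variable {φ : L2 d} (hφ : IsBessel fun k : Fin d → ℤ => translation (intVec k) φ)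

theorem norm_sq_analysis_eq_integral {x : L2 d}
    (hinner : MemLp (fun s => (inner ℂ (FT d φ s) (FT d x s) : ℂ)) 2 volume)
    (hx : ∀ᵐ s, s ∉ cube d → FT d x s = 0) :
    ‖analysis hφ x‖ ^ 2 = ∫ s, ‖(inner ℂ (FT d φ s) (FT d x s) : ℂ)‖ ^ 2 := by
  have hsum := hasSum_sq_norm_integral_wave_mul hinner
    (hx.mono fun s hs hsc => by rw [hs hsc, inner_zero_right])
  rw [← (Equiv.neg (Fin d → ℤ)).hasSum_iff] at hsum
  refine (hasSum_sq_analysis hφ x).unique (hsum.congr_fun fun k => ?_)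
  have hcoeff := inner_translation_translation (intVec k) 0 φ x
  rw [translation_zero, zero_sub, ← intVec_neg] at hcoeff
  rw [hcoeff]
  rfl

theorem mul_norm_le_norm_analysis {δ c C : ℝ} (hc : 0 ≤ c) (hδ : δ ≤ 1 / 2)
    (hbound : ∀ᵐ s, ‖s‖ < δ → c ≤ ‖FT d φ s‖ ∧ ‖FT d φ s‖ ≤ C) {x : L2 d}
    (hx : ∀ᵐ s, δ ≤ ‖s‖ → FT d x s = 0) : c * ‖x‖ ≤ ‖analysis hφ x‖ := by
  let H (s : Euc d) : ℂ := inner ℂ (FT d φ s) (FT d x s)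
  have hH : ∀ᵐ s, c * ‖FT d x s‖ ≤ ‖H s‖ ∧ ‖H s‖ ≤ C * ‖FT d x s‖ := by
    filter_upwards [hbound, hx] with s hs hxs
    rcases lt_or_ge ‖s‖ δ with hlt | hge
    · have hnorm : ‖H s‖ = ‖FT d φ s‖ * ‖FT d x s‖ := by
        simp only [H, RCLike.inner_apply', norm_mul, RCLike.norm_conj]
      rw [hnorm]
      exact ⟨by gcongr; exact (hs hlt).1, by gcongr; exact (hs hlt).2⟩
    · simp [H, hxs hge]
  have hHm : MemLp H 2 volume :=
    (Lp.memLp (FT d x)).of_le_mul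
      ((Lp.aestronglyMeasurable _).inner (Lp.aestronglyMeasurable _)) (hH.mono fun _ hs => hs.2)
  have hxcube : ∀ᵐ s, s ∉ cube d → FT d x s = 0 := by
    filter_upwards [hx] with s hs hcube
    refine hs (hδ.trans (not_lt.mp fun hlt => hcube (ball_subset_cube ?_)))
    exact mem_ball_zero_iff.mpr hlt
  refine le_of_sq_le_sq ?_ (norm_nonneg _)
  rw [norm_sq_analysis_eq_integral hφ hHm hxcube, ← (FT d).norm_map, mul_pow, norm_sq_eq_integral,
    ← integral_const_mul]
  refine integral_mono_ae ((Lp.memLp (FT d x)).integrable_norm_pow two_ne_zero |>.const_mul _)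
    (hHm.integrable_norm_pow two_ne_zero) ?_
  filter_upwards [hH] with s hs
  rw [← mul_pow]
  gcongr
  exact hs.1

theorem FT_dilation_inv_pow_eq_zero_of_le_norm {M : Matrix (Fin d) (Fin d) ℝ} (hM : M.det ≠ 0)
    {n : ℕ} {R δ : ℝ} (hshrink : ∀ s, ‖s‖ < R → ‖act (Mᵀ⁻¹ ^ n) s‖ < δ) {g : L2 d}
    (hg : ∀ᵐ s, R ≤ ‖s‖ → FT d g s = 0) :
    ∀ᵐ s, δ ≤ ‖s‖ → FT d (((dilation M)⁻¹ ^ n) g) s = 0 := by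
  have hMn : (M⁻¹ ^ n).det ≠ 0 := by
    rw [Matrix.det_pow]
    exact pow_ne_zero _ (det_inv_ne_zero hM)
  have hinv : (M⁻¹ ^ n)ᵀ⁻¹⁻¹ = Mᵀ⁻¹ ^ n := by
    rw [Matrix.nonsing_inv_nonsing_inv _ (isUnit_iff_ne_zero.mpr (det_transpose_ne_zero hMn)),
      Matrix.transpose_pow, Matrix.transpose_nonsing_inv]
  rw [dilation_inv hM, dilation_pow (det_inv_ne_zero hM), FT_dilation hMn]
  exact dilation_eq_zero_of_le_norm (det_transpose_inv_ne_zero hMn) (by rwa [hinv]) hg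

theorem tendsto_norm_analysis_dilation_inv {G : Euc d → ℂ} (hG : FT d φ =ᵐ[volume] G)
    (hG0 : Filter.Tendsto G (nhds 0) (nhds 1)) {M : Matrix (Fin d) (Fin d) ℝ} (hM : M.det ≠ 0)
    (hc : IsContracting Mᵀ⁻¹) (f : L2 d) :
    Filter.Tendsto (fun n : ℕ => ‖analysis hφ (((dilation M)⁻¹ ^ n) f)‖) Filter.atTop
      (nhds ‖f‖) := by
  rw [← one_mul ‖f‖]
  refine tendsto_norm_analysis_of_dense hφ (fun n => (dilation M)⁻¹ ^ n)
    dense_setOf_bounded_spectrum (fun g ⟨R, hg⟩ => ?_) f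
  have hle (n : ℕ) : ‖analysis hφ (((dilation M)⁻¹ ^ n) g)‖ ≤ ‖g‖ :=
    (norm_analysis_le hφ _).trans_eq (LinearIsometryEquiv.norm_map _ _)
  rw [one_mul]
  refine tendsto_order.mpr ⟨fun b hb => ?_, fun b hb =>
    Filter.Eventually.of_forall fun n => (hle n).trans_lt hb⟩
  obtain ⟨c, hbc, hc0, hc1⟩ : ∃ c : ℝ, b < c * ‖g‖ ∧ 0 < c ∧ c < 1 := by
    have hlim : Filter.Tendsto (fun c : ℝ => c * ‖g‖) (nhdsWithin 1 (Set.Iio 1)) (nhds ‖g‖) :=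
      tendsto_nhdsWithin_of_tendsto_nhds (by simpa using (continuous_mul_const ‖g‖).tendsto 1)
    exact ((hlim.eventually_const_lt hb).and (Ioo_mem_nhdsLT one_pos)).exists
  have hnear : ∀ᶠ s in nhds (0 : Euc d), c ≤ ‖G s‖ ∧ ‖G s‖ ≤ 2 := by
    have hnorm := hG0.norm
    rw [norm_one] at hnorm
    exact (hnorm.eventually_const_le hc1).and (hnorm.eventually_le_const one_lt_two)
  obtain ⟨δ, hδ, hball⟩ := Metric.eventually_nhds_iff_ball.mp hnear
  filter_upwards [hc.eventually_norm_act_pow_lt R (lt_min hδ (half_pos one_pos))] with n hshrink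
  refine hbc.trans_le ?_
  rw [← LinearIsometryEquiv.norm_map ((dilation M)⁻¹ ^ n) g]
  refine mul_norm_le_norm_analysis hφ (C := 2) hc0.le (min_le_right δ (1 / 2)) ?_
    (FT_dilation_inv_pow_eq_zero_of_le_norm hM hshrink hg)
  filter_upwards [hG] with s hs hsδ
  rw [hs]
  exact hball s (mem_ball_zero_iff.mpr (hsδ.trans_le (min_le_left _ _)))

end HighResolution

/-! ### Low resolution -/

theorem one_le_dist_intVec {k l : Fin d → ℤ} (hkl : k ≠ l) : 1 ≤ dist (intVec k) (intVec l) := by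
  obtain ⟨i, hi⟩ := Function.ne_iff.mp hkl
  calc (1 : ℝ) ≤ |((k i - l i : ℤ) : ℝ)| := by
        rw [← Int.cast_abs]
        exact_mod_cast Int.one_le_abs (sub_ne_zero.mpr hi)
    _ = ‖(intVec k - intVec l) i‖ := by rw [Int.cast_sub]; rfl
    _ ≤ dist (intVec k) (intVec l) := dist_eq_norm (intVec k) _ ▸ PiLp.norm_apply_le _ i

theorem pairwise_disjoint_ball_intVec :
    Pairwise (Function.onFun Disjoint fun k : Fin d → ℤ => Metric.ball (intVec k) (1 / 2 : ℝ)) :=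
  fun _ _ hkl => Metric.ball_disjoint_ball ((add_halves (1 : ℝ)).trans_le (one_le_dist_intVec hkl))

theorem lintegral_periodization_ne_top (φ : L2 d) :
    ∫⁻ t in Metric.ball 0 (1 / 2), ∑' k : Fin d → ℤ, ‖φ (t - intVec k)‖ₑ ^ 2 ≠ ⊤ := by
  have hφ : Measurable fun t => ‖φ t‖ₑ ^ 2 :=
    (Lp.stronglyMeasurable φ).measurable.enorm.pow_const 2
  have hsub (k : Fin d → ℤ) : MeasurePreserving (fun t : Euc d => t - intVec k) volume volume :=
    measurePreserving_sub_right volume (intVec k)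
  have hshift (k : Fin d → ℤ) : ∫⁻ t in Metric.ball 0 (1 / 2), ‖φ (t - intVec k)‖ₑ ^ 2 =
      ∫⁻ t in Metric.ball (intVec (-k)) (1 / 2), ‖φ t‖ₑ ^ 2 := by
    rw [← (hsub k).setLIntegral_comp_preimage measurableSet_ball hφ]
    congr 2
    ext t
    simp [dist_eq_norm, intVec_neg]
  rw [lintegral_tsum fun k : Fin d → ℤ => show AEMeasurable (fun t => ‖φ (t - intVec k)‖ₑ ^ 2) _
    from (hφ.comp (hsub k).measurable).aemeasurable]
  simp only [hshift]
  rw [← lintegral_iUnion (fun _ => measurableSet_ball)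
    (pairwise_disjoint_ball_intVec.comp_of_injective neg_injective)]
  refine ne_top_of_le_ne_top ?_ (setLIntegral_le_lintegral _ _)
  rw [← enorm_sq_eq_lintegral]
  exact ENNReal.pow_ne_top enorm_ne_top

theorem exists_setLIntegral_ball_lt {X : Type*} [MetricSpace X] [ProperSpace X]
    [MeasurableSpace X] [OpensMeasurableSpace X] {μ : Measure X} [IsFiniteMeasureOnCompacts μ]
    [NullSingletonClass μ] {x : X} {r : ℝ} (hr : 0 < r) {f : X → ENNReal}
    (hf : ∫⁻ t in Metric.ball x r, f t ∂μ ≠ ⊤) {ε : ENNReal} (hε : 0 < ε) :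
    ∃ δ : ℝ, 0 < δ ∧ ∫⁻ t in Metric.ball x δ, f t ∂μ < ε := by
  have hball : Filter.Tendsto (fun δ => μ (Metric.ball x δ)) (nhdsWithin 0 (Set.Ioi 0))
      (nhds 0) := by
    have hlim := tendsto_measure_cthickening_of_isCompact (μ := μ) (isCompact_singleton (x := x))
    rw [measure_singleton] at hlim
    refine tendsto_of_tendsto_of_tendsto_of_le_of_le' tendsto_const_nhds
      (hlim.mono_left nhdsWithin_le_nhds) (Filter.Eventually.of_forall fun _ => zero_le) ?_
    filter_upwards [self_mem_nhdsWithin] with δ hδ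
    rw [Metric.cthickening_singleton _ hδ.le]
    exact measure_mono Metric.ball_subset_closedBall
  have hrestrict : Filter.Tendsto (μ.restrict (Metric.ball x r) ∘ Metric.ball x)
      (nhdsWithin 0 (Set.Ioi 0)) (nhds 0) :=
    tendsto_of_tendsto_of_tendsto_of_le_of_le tendsto_const_nhds hball (fun _ => zero_le)
      fun _ => Measure.restrict_apply_le _ _
  obtain ⟨δ, hlt, hδ, hδr⟩ := (((tendsto_setLIntegral_zero hf hrestrict).eventually_lt_const
    hε).and (Ioo_mem_nhdsGT hr)).exists
  rw [Measure.restrict_restrict measurableSet_ball,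
    Set.inter_eq_self_of_subset_left (Metric.ball_subset_ball hδr.le)] at hlt
  exact ⟨δ, hδ, hlt⟩

theorem enorm_inner_sq_le_setLIntegral {α E : Type*} [MeasurableSpace α] {μ : Measure α}
    [NormedAddCommGroup E] [InnerProductSpace ℂ E] {s : Set α} (hs : MeasurableSet s)
    (f g : Lp E 2 μ) (hg : ∀ᵐ t ∂μ, t ∉ s → g t = 0) :
    ‖(inner ℂ f g : ℂ)‖ₑ ^ 2 ≤ (∫⁻ t in s, ‖f t‖ₑ ^ 2 ∂μ) * ‖g‖ₑ ^ 2 := by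
  have hmem : MemLp (s.indicator f) 2 μ := (Lp.memLp f).indicator hs
  have hinner : (inner ℂ f g : ℂ) = inner ℂ (hmem.toLp _) g := by
    rw [L2.inner_def, L2.inner_def]
    refine integral_congr_ae ?_
    filter_upwards [hg, hmem.coeFn_toLp] with t ht hcoe
    rw [hcoe]
    by_cases hts : t ∈ s
    · rw [Set.indicator_of_mem hts]
    · rw [ht hts, inner_zero_right, inner_zero_right]
  have hnorm : ‖hmem.toLp _‖ₑ ^ 2 = ∫⁻ t in s, ‖f t‖ₑ ^ 2 ∂μ := by
    rw [enorm_sq_eq_lintegral, ← lintegral_indicator hs]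
    refine lintegral_congr_ae ?_
    filter_upwards [hmem.coeFn_toLp] with t ht
    rw [ht]
    by_cases hts : t ∈ s <;> simp [hts]
  rw [hinner, ← hnorm, ← mul_pow]
  gcongr
  simp only [enorm_eq_nnnorm]
  exact_mod_cast nnnorm_inner_le_nnnorm (𝕜 := ℂ) (hmem.toLp _) g

section LowResolution

variable {φ : L2 d} (hφ : IsBessel fun k : Fin d → ℤ => translation (intVec k) φ)

theorem exists_norm_analysis_le (hd : 0 < d) {ε : NNReal} (hε : 0 < ε) :
    ∃ δ : ℝ, 0 < δ ∧ ∀ x : L2 d, (∀ᵐ t, δ ≤ ‖t‖ → x t = 0) → ‖analysis hφ x‖ ≤ ε * ‖x‖ := by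
  have : Nonempty (Fin d) := ⟨⟨0, hd⟩⟩
  obtain ⟨δ, hδ, hlt⟩ := exists_setLIntegral_ball_lt (half_pos one_pos)
    (lintegral_periodization_ne_top φ) (ε := ε ^ 2) (by positivity)
  refine ⟨δ, hδ, fun x hx => norm_analysis_le_of_sum_le hφ (by positivity) fun F => ?_⟩
  have hcoeff (k : Fin d → ℤ) : ‖(inner ℂ (translation (intVec k) φ) x : ℂ)‖ₑ ^ 2 ≤
      (∫⁻ t in Metric.ball 0 δ, ‖φ (t - intVec k)‖ₑ ^ 2) * ‖x‖ₑ ^ 2 := by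
    have htrans : ∫⁻ t in Metric.ball 0 δ, ‖translation (intVec k) φ t‖ₑ ^ 2 =
        ∫⁻ t in Metric.ball 0 δ, ‖φ (t - intVec k)‖ₑ ^ 2 := by
      refine setLIntegral_congr_fun_ae measurableSet_ball ?_
      filter_upwards [coeFn_translation (intVec k) φ] with t ht _
      rw [ht]
    rw [← htrans]
    refine enorm_inner_sq_le_setLIntegral measurableSet_ball _ x ?_
    simpa using hx
  have hsum : ∑ k ∈ F, ∫⁻ t in Metric.ball 0 δ, ‖φ (t - intVec k)‖ₑ ^ 2 ≤ (ε : ENNReal) ^ 2 := by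
    rw [← lintegral_finsetSum']
    · exact (lintegral_mono fun t => ENNReal.sum_le_tsum F).trans hlt.le
    · exact fun k _ => (((Lp.stronglyMeasurable φ).measurable.enorm.pow_const 2).comp
        (measurePreserving_sub_right volume (intVec k)).measurable).aemeasurable
  have hle : ∑ k ∈ F, ‖(inner ℂ (translation (intVec k) φ) x : ℂ)‖ₑ ^ 2 ≤ (ε * ‖x‖ₑ) ^ 2 :=
    calc _ ≤ ∑ k ∈ F, (∫⁻ t in Metric.ball 0 δ, ‖φ (t - intVec k)‖ₑ ^ 2) * ‖x‖ₑ ^ 2 :=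
          Finset.sum_le_sum fun k _ => hcoeff k
      _ ≤ (ε * ‖x‖ₑ) ^ 2 := by rw [← Finset.sum_mul, mul_pow]; gcongr
  simp only [enorm_eq_nnnorm] at hle
  simp only [← coe_nnnorm]
  exact_mod_cast hle

theorem tendsto_norm_analysis_dilation (hd : 0 < d) {M : Matrix (Fin d) (Fin d) ℝ} (hM : M.det ≠ 0)
    (hc : IsContracting M⁻¹) (f : L2 d) :
    Filter.Tendsto (fun n : ℕ => ‖analysis hφ ((dilation M ^ n) f)‖) Filter.atTop (nhds 0) := by
  rw [← zero_mul ‖f‖]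
  refine tendsto_norm_analysis_of_dense hφ (fun n => dilation M ^ n)
    dense_setOf_bounded_support (fun g ⟨R, hg⟩ => ?_) f
  have hMn (n : ℕ) : (M ^ n).det ≠ 0 := by
    rw [Matrix.det_pow]
    exact pow_ne_zero _ hM
  rw [zero_mul, tendsto_order]
  refine ⟨fun b hb => Filter.Eventually.of_forall fun n => hb.trans_le (norm_nonneg _),
    fun b hb => ?_⟩
  obtain ⟨ε, hε, hεb⟩ := exists_pos_mul_lt hb ‖g‖
  lift ε to NNReal using hε.le
  obtain ⟨δ, hδ, hsmall⟩ := exists_norm_analysis_le hφ hd (NNReal.coe_pos.mp hε)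
  filter_upwards [hc.eventually_norm_act_pow_lt R hδ] with n hshrink
  have hsupp : ∀ᵐ t, δ ≤ ‖t‖ → (dilation M ^ n) g t = 0 := by
    rw [dilation_pow hM]
    exact dilation_eq_zero_of_le_norm (hMn n) (by rwa [← Matrix.inv_pow']) hg
  calc ‖analysis hφ ((dilation M ^ n) g)‖ ≤ ε * ‖(dilation M ^ n) g‖ := hsmall _ hsupp
    _ = ‖g‖ * ε := by rw [LinearIsometryEquiv.norm_map, mul_comm]
    _ < b := hεb

end LowResolution

/-! ### Perfect reconstruction -/

theorem exists_norm_eq_hasSum_of_orthonormal {κ ι : Type*} {v : κ → lp (fun _ : ι => ℂ) 2}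
    (hv : Orthonormal ℂ v) (a : lp (fun _ : κ => ℂ) 2) :
    ∃ x : lp (fun _ : ι => ℂ) 2, ‖x‖ = ‖a‖ ∧ ∀ i, HasSum (fun k => a k * v k i) (x i) :=
  ⟨hv.orthogonalFamily.linearIsometry a, LinearIsometry.norm_map _ _, fun i =>
    (hv.orthogonalFamily.hasSum_linearIsometry a).mapL (lp.evalCLM ℂ (fun _ : ι => ℂ) 2 i)⟩

/-- The high-pass filter `(-1)^(q·n) conj(h_{l-n})` paired with the low-pass filter `h`. -/
def highPass (l q : Fin d → ℤ) (h : (Fin d → ℤ) → ℂ) (n : Fin d → ℤ) : ℂ :=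
  (-1 : ℂ) ^ (q ⬝ᵥ n) * (starRingEnd ℂ) (h (l - n))

/-- The `k`-th row of the polyphase matrix of the filters `h` and `g`: its entries are the
conjugates of `h (k - A m)` in the first half and of `g (k - A m)` in the second. -/
def polyphase (A : Matrix (Fin d) (Fin d) ℤ) (h g : (Fin d → ℤ) → ℂ) (k : Fin d → ℤ) :
    (Fin d → ℤ) ⊕ (Fin d → ℤ) → ℂ
  | .inl m => (starRingEnd ℂ) (h (k - A *ᵥ m))
  | .inr m => (starRingEnd ℂ) (g (k - A *ᵥ m))

section Reconstruction

variable {A : Matrix (Fin d) (Fin d) ℤ} {N : ℕ} {h g : (Fin d → ℤ) → ℂ} {l q : Fin d → ℤ}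
  {s t : Finset (Fin d → ℤ)}

theorem highPass_eq_zero (hs : ∀ n, n ∉ s → h n = 0) (n : Fin d → ℤ)
    (hn : n ∉ s.image fun m => l - m) : highPass l q h n = 0 := by
  rw [highPass, hs, map_zero, mul_zero]
  exact fun hmem => hn (Finset.mem_image.mpr ⟨l - n, hmem, sub_sub_cancel l n⟩)

theorem finite_setOf_sub_mulVec_mem (hdet : A.det ≠ 0) (s : Finset (Fin d → ℤ))
    (k : Fin d → ℤ) : {m | k - A *ᵥ m ∈ s}.Finite :=
  s.finite_toSet.preimage
    (sub_right_injective.comp (Matrix.mulVec_injective_of_det_ne_zero hdet)).injOn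

theorem finite_support_polyphase (hdet : A.det ≠ 0) (hs : ∀ n, n ∉ s → h n = 0)
    (ht : ∀ n, n ∉ t → g n = 0) (k : Fin d → ℤ) : {i | polyphase A h g k i ≠ 0}.Finite := by
  refine (((finite_setOf_sub_mulVec_mem hdet s k).image Sum.inl).union
    ((finite_setOf_sub_mulVec_mem hdet t k).image Sum.inr)).subset ?_
  rintro (m | m) hm
  · exact Or.inl ⟨m, not_imp_comm.mp (hs _) (by simpa [polyphase] using hm), rfl⟩
  · exact Or.inr ⟨m, not_imp_comm.mp (ht _) (by simpa [polyphase] using hm), rfl⟩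

theorem memℓp_polyphase (hdet : A.det ≠ 0) (hs : ∀ n, n ∉ s → h n = 0)
    (ht : ∀ n, n ∉ t → g n = 0) (k : Fin d → ℤ) : Memℓp (polyphase A h g k) 2 :=
  (memℓp_zero (finite_support_polyphase hdet hs ht k)).of_exponent_ge (by simp)

theorem hasSum_add_mulVec (hdet : A.det ≠ 0) (hq : ∀ x, x ∈ lattice A ↔ Even (q ⬝ᵥ x))
    (hs : ∀ n, n ∉ s → h n = 0) (c : Fin d → ℤ) :
    HasSum (fun m => h (c + A *ᵥ m)) (∑ n ∈ s with Even (q ⬝ᵥ (n - c)), h n) := by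
  have hinj : Function.Injective fun m => c + A *ᵥ m :=
    (add_right_injective c).comp (Matrix.mulVec_injective_of_det_ne_zero hdet)
  have hcoset (n) : Even (q ⬝ᵥ (n - c)) ↔ n ∈ Set.range fun m => c + A *ᵥ m := by
    rw [← hq]
    exact exists_congr fun m => eq_sub_iff_add_eq'
  have hsum := hasSum_sum_of_ne_finset_zero (L := .unconditional _) (s := s)
    (f := fun n => if Even (q ⬝ᵥ (n - c)) then h n else 0) fun n hn => by simp [hs n hn]
  rw [← hinj.hasSum_iff fun n hn => if_neg fun he => hn ((hcoset n).mp he),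
    ← Finset.sum_filter] at hsum
  exact hsum.congr_fun fun m => (if_pos ((hcoset _).mpr ⟨m, rfl⟩)).symm

theorem hasSum_lowPass_rows (hdet : A.det ≠ 0) (hq : ∀ x, x ∈ lattice A ↔ Even (q ⬝ᵥ x))
    (hs : ∀ n, n ∉ s → h n = 0) (k k' : Fin d → ℤ) :
    HasSum (fun m => h (k - A *ᵥ m) * (starRingEnd ℂ) (h (k' - A *ᵥ m)))
      (∑ n ∈ s with Even (q ⬝ᵥ (n - k)), h n * (starRingEnd ℂ) (h (n + (k' - k)))) := by
  refine ((Equiv.neg (Fin d → ℤ)).hasSum_iff.mpr (hasSum_add_mulVec hdet hq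
    (h := fun n => h n * (starRingEnd ℂ) (h (n + (k' - k))))
    (fun n hn => by rw [hs n hn, zero_mul]) k)).congr_fun fun m => ?_
  rw [Function.comp_apply, Equiv.neg_apply, Matrix.mulVec_neg, ← sub_eq_add_neg,
    sub_add_sub_cancel']

theorem neg_one_zpow_mul_neg_one_zpow (x y : ℤ) : (-1 : ℂ) ^ x * (-1) ^ y = (-1) ^ (x - y) := by
  rw [zpow_sub₀ (by norm_num), div_eq_mul_inv, ← inv_zpow, inv_neg_one]

theorem highPass_mul_conj_highPass (l q : Fin d → ℤ) (h : (Fin d → ℤ) → ℂ) (k k' : Fin d → ℤ) :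
    highPass l q h k * (starRingEnd ℂ) (highPass l q h k') =
      (-1 : ℂ) ^ (q ⬝ᵥ (k - k')) * (h (l - k') * (starRingEnd ℂ) (h (l - k))) := by
  rw [dotProduct_sub, ← neg_one_zpow_mul_neg_one_zpow]
  simp only [highPass, map_mul, map_zpow₀, map_neg, map_one, Complex.conj_conj]
  ring

theorem hasSum_highPass_rows (hdet : A.det ≠ 0) (hq : ∀ x, x ∈ lattice A ↔ Even (q ⬝ᵥ x))
    (hs : ∀ n, n ∉ s → h n = 0) (l k k' : Fin d → ℤ) :
    HasSum (fun m => highPass l q h (k - A *ᵥ m) *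
        (starRingEnd ℂ) (highPass l q h (k' - A *ᵥ m)))
      ((-1 : ℂ) ^ (q ⬝ᵥ (k - k')) * ∑ n ∈ s with Even (q ⬝ᵥ (n - (l - k'))),
        h n * (starRingEnd ℂ) (h (n + (k' - k)))) := by
  refine ((hasSum_add_mulVec hdet hq (h := fun n => h n * (starRingEnd ℂ) (h (n + (k' - k))))
    (fun n hn => by rw [hs n hn, zero_mul]) (l - k')).mul_left _).congr_fun fun m => ?_
  rw [highPass_mul_conj_highPass, sub_sub_sub_cancel_right]
  congr 5 <;> abel

-- If `q·(k' - k)` is even, the two sums run over complementary cosets and add up to a Lawton sum;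
-- if it is odd, they run over the same coset and cancel.
theorem IsFiniteLawtonSolution.sum_filter_add_sum_filter (hh : IsFiniteLawtonSolution A N h)
    (hq : ∀ x, x ∈ lattice A ↔ Even (q ⬝ᵥ x)) (hl : Odd (q ⬝ᵥ l)) (k k' : Fin d → ℤ) :
    (∑ n ∈ box d N with Even (q ⬝ᵥ (n - k)), h n * (starRingEnd ℂ) (h (n + (k' - k)))) +
        (-1 : ℂ) ^ (q ⬝ᵥ (k - k')) * ∑ n ∈ box d N with Even (q ⬝ᵥ (n - (l - k'))),
          h n * (starRingEnd ℂ) (h (n + (k' - k))) = if k = k' then 1 else 0 := by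
  have hl' : ¬Even (q ⬝ᵥ l) := Int.not_even_iff_odd.mpr hl
  by_cases hkk' : Even (q ⬝ᵥ k') ↔ Even (q ⬝ᵥ k)
  · have hmem : k' - k ∈ lattice A := by rwa [hq, dotProduct_sub, Int.even_sub]
    have hcompl (n) : Even (q ⬝ᵥ (n - (l - k'))) ↔ ¬Even (q ⬝ᵥ (n - k)) := by
      simp only [dotProduct_sub, Int.even_sub]
      tauto
    have heven : Even (q ⬝ᵥ (k - k')) := by rwa [dotProduct_sub, Int.even_sub, iff_comm]
    simp only [hcompl, heven.neg_one_zpow, one_mul, Finset.sum_filter_add_sum_filter_not,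
      hh.sum_mul_conj hmem, sub_eq_zero, eq_comm]
  · have hsame (n) : Even (q ⬝ᵥ (n - (l - k'))) ↔ Even (q ⬝ᵥ (n - k)) := by
      simp only [dotProduct_sub, Int.even_sub]
      tauto
    have hodd : Odd (q ⬝ᵥ (k - k')) := by
      rwa [← Int.not_even_iff_odd, dotProduct_sub, Int.even_sub, iff_comm]
    have hne : k ≠ k' := fun heq => hkk' (heq ▸ Iff.rfl)
    simp only [hsame, hodd.neg_one_zpow, neg_one_mul, add_neg_cancel, if_neg hne]

theorem IsFiniteLawtonSolution.hasSum_inner_polyphase (hh : IsFiniteLawtonSolution A N h)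
    (hdet : A.det ≠ 0) (hq : ∀ x, x ∈ lattice A ↔ Even (q ⬝ᵥ x)) (hl : Odd (q ⬝ᵥ l))
    (k k' : Fin d → ℤ) :
    HasSum (fun i => (inner ℂ (polyphase A h (highPass l q h) k i)
      (polyphase A h (highPass l q h) k' i) : ℂ)) (if k = k' then 1 else 0) := by
  rw [← hh.sum_filter_add_sum_filter hq hl]
  refine HasSum.sum ((hasSum_lowPass_rows hdet hq hh.finite k k').congr_fun fun m => ?_)
    ((hasSum_highPass_rows hdet hq hh.finite l k k').congr_fun fun m => ?_) <;>
  simp only [Function.comp_apply, polyphase, RCLike.inner_apply, Complex.conj_conj, mul_comm]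

theorem IsFiniteLawtonSolution.exists_orthonormal_polyphase (hh : IsFiniteLawtonSolution A N h)
    (hdet : A.det ≠ 0) (hq : ∀ x, x ∈ lattice A ↔ Even (q ⬝ᵥ x)) (hl : Odd (q ⬝ᵥ l)) :
    ∃ v : (Fin d → ℤ) → lp (fun _ : (Fin d → ℤ) ⊕ (Fin d → ℤ) => ℂ) 2,
      Orthonormal ℂ v ∧ ∀ k i, v k i = polyphase A h (highPass l q h) k i := by
  refine ⟨fun k => ⟨_, memℓp_polyphase hdet hh.finite (highPass_eq_zero hh.finite) k⟩,
    orthonormal_iff_ite.mpr fun k k' => ?_, fun k i => rfl⟩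
  exact (lp.hasSum_inner _ _).unique (hh.hasSum_inner_polyphase hdet hq hl k k')

variable {φ : L2 d}

theorem inner_dilation_left (f g : L2 d) (M : Matrix (Fin d) (Fin d) ℝ) :
    (inner ℂ (dilation M f) g : ℂ) = inner ℂ f ((dilation M)⁻¹ g) :=
  (dilation M).inner_map_eq_flip f g

theorem hasSum_inner_translation_sum (hdet : A.det ≠ 0) (f : L2 d) (hs : ∀ n, n ∉ s → g n = 0)
    (m : Fin d → ℤ) :
    HasSum (fun k => (inner ℂ (translation (intVec k) φ) ((dilation (toReal A))⁻¹ f) : ℂ) *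
      (starRingEnd ℂ) (g (k - A *ᵥ m)))
      (inner ℂ (translation (intVec m)
        (∑ n ∈ s, g n • dilation (toReal A) (translation (intVec n) φ))) f) := by
  rw [translation_sum_dilation hdet, sum_inner, ← (Equiv.addLeft (A *ᵥ m)).hasSum_iff]
  refine (hasSum_sum_of_ne_finset_zero (L := .unconditional _) (s := s) (f := fun n => (inner ℂ
    (g n • dilation (toReal A) (translation (intVec (A *ᵥ m + n)) φ)) f : ℂ)) fun n hn => by
      rw [hs n hn, zero_smul, inner_zero_left]).congr_fun fun n => ?_
  rw [Function.comp_apply, Equiv.coe_addLeft, add_sub_cancel_left, inner_smul_left,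
    inner_dilation_left, mul_comm]

theorem IsFiniteLawtonSolution.wavelet_eq (hh : IsFiniteLawtonSolution A N h) (φ : L2 d) :
    wavelet A l q h φ = ∑ n ∈ (box d N).image (fun m => l - m),
      highPass l q h n • dilation (toReal A) (translation (intVec n) φ) := by
  refine finsum_eq_sum_of_support_subset _ (Function.support_subset_iff'.mpr fun n hn => ?_)
  change highPass l q h n • _ = _
  rw [highPass_eq_zero hh.finite n hn, zero_smul]

-- The coefficients of `f` against the translates of `φ` and of the wavelet are together the image
-- of those of `D_A⁻¹ f` under the polyphase isometry.
theorem IsFiniteLawtonSolution.exists_norm_eq_norm_analysis (hh : IsFiniteLawtonSolution A N h)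
    (hdet : A.det ≠ 0) (hq : ∀ x, x ∈ lattice A ↔ Even (q ⬝ᵥ x)) (hl : Odd (q ⬝ᵥ l))
    (hφ : IsBessel fun k : Fin d → ℤ => translation (intVec k) φ)
    (href : φ = refinement A N h φ) (f : L2 d) :
    ∃ x : lp (fun _ : (Fin d → ℤ) ⊕ (Fin d → ℤ) => ℂ) 2,
      ‖x‖ = ‖analysis hφ ((dilation (toReal A))⁻¹ f)‖ ∧
      (∀ m, x (.inl m) = inner ℂ (translation (intVec m) φ) f) ∧
      ∀ m, x (.inr m) = inner ℂ (translation (intVec m) (wavelet A l q h φ)) f := by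
  obtain ⟨v, hv, hrow⟩ := hh.exists_orthonormal_polyphase hdet hq hl
  obtain ⟨x, hx, hsum⟩ := exists_norm_eq_hasSum_of_orthonormal hv
    (analysis hφ ((dilation (toReal A))⁻¹ f))
  simp only [hrow, analysis_apply] at hsum
  refine ⟨x, hx, fun m => (hsum (.inl m)).unique ?_, fun m => (hsum (.inr m)).unique ?_⟩
  · have hlow := hasSum_inner_translation_sum (φ := φ) hdet f hh.finite m
    rwa [← refinement, ← href] at hlow
  · rw [hh.wavelet_eq]
    exact hasSum_inner_translation_sum hdet f (highPass_eq_zero hh.finite) m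

theorem IsFiniteLawtonSolution.hasSum_sq_norm_inner_wavelet (hh : IsFiniteLawtonSolution A N h)
    (hdet : A.det ≠ 0) (hq : ∀ x, x ∈ lattice A ↔ Even (q ⬝ᵥ x)) (hl : Odd (q ⬝ᵥ l))
    (hφ : IsBessel fun k : Fin d → ℤ => translation (intVec k) φ)
    (href : φ = refinement A N h φ) (f : L2 d) :
    HasSum (fun m => ‖(inner ℂ (translation (intVec m) (wavelet A l q h φ)) f : ℂ)‖ ^ 2)
      (‖analysis hφ ((dilation (toReal A))⁻¹ f)‖ ^ 2 - ‖analysis hφ f‖ ^ 2) := by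
  obtain ⟨x, hx, hlow, hhigh⟩ := hh.exists_norm_eq_norm_analysis hdet hq hl hφ href f
  have htotal : HasSum (fun i => ‖x i‖ ^ 2) (‖analysis hφ ((dilation (toReal A))⁻¹ f)‖ ^ 2) := by
    simpa [hx] using lp.hasSum_norm (p := 2) (by simp) x
  have hsplit : HasSum ((fun i => ‖x i‖ ^ 2) ∘ Sum.inl) (‖analysis hφ f‖ ^ 2) := by
    simpa only [Function.comp_def, hlow] using hasSum_sq_analysis hφ f
  have hsummable := htotal.summable.comp_injective Sum.inr_injective
  rw [htotal.unique (hsplit.sum hsummable.hasSum), add_sub_cancel_left]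
  simpa only [Function.comp_def, hhigh] using hsummable.hasSum

end Reconstruction

/-! ### The Parseval frame property -/

theorem hasSum_sub_of_monotone {u : ℕ → ℝ} (hu : Monotone u) {a : ℝ}
    (ha : Filter.Tendsto u Filter.atTop (nhds a)) :
    HasSum (fun n => u (n + 1) - u n) (a - u 0) := by
  rw [hasSum_iff_tendsto_nat_of_nonneg fun n => sub_nonneg.mpr (hu n.le_succ)]
  simpa only [Finset.sum_range_sub] using ha.sub_const _

theorem hasSum_sub_of_antitone {u : ℕ → ℝ} (hu : Antitone u) {a : ℝ}
    (ha : Filter.Tendsto u Filter.atTop (nhds a)) :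
    HasSum (fun n => u n - u (n + 1)) (u 0 - a) := by
  simpa only [neg_sub_neg] using hasSum_sub_of_monotone hu.neg ha.neg

theorem hasSum_int_sub_of_monotone {u : ℤ → ℝ} (hu : Monotone u) {a b : ℝ}
    (ha : Filter.Tendsto (fun n : ℕ => u n) Filter.atTop (nhds a))
    (hb : Filter.Tendsto (fun n : ℕ => u (-n)) Filter.atTop (nhds b)) :
    HasSum (fun n : ℤ => u (n + 1) - u n) (a - b) := by
  have hpos := hasSum_sub_of_monotone (fun m n hmn => hu (by exact_mod_cast hmn)) ha
  have hneg := hasSum_sub_of_antitone (fun m n hmn => hu (by lia)) hb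
  have hint := HasSum.of_nat_of_neg_add_one (f := fun n : ℤ => u (n + 1) - u n)
    (by simpa using hpos) (hneg.congr_fun fun n => by simp)
  simpa using hint

theorem hasSum_prod_of_nonneg {α β : Type*} {F : α × β → ℝ} (hF : ∀ p, 0 ≤ F p) {r : α → ℝ}
    {a : ℝ} (hr : ∀ x, HasSum (fun y => F (x, y)) (r x)) (ha : HasSum r a) : HasSum F a := by
  have hsummable : Summable F := (summable_prod_of_nonneg hF).mpr
    ⟨fun x => (hr x).summable, by simpa only [(hr _).tsum_eq] using ha.summable⟩
  exact (hsummable.hasSum.prod_fiberwise hr).unique ha ▸ hsummable.hasSum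

-- The analysis energies of `D^(-n) f` increase with `n`, from `0` at `-∞` to `‖f‖²` at `+∞`, and
-- the coefficients of `f` at level `n` account for the `n`-th increment.
theorem isNormalizedTightFrame_of_level_energy {φ ψ : L2 d}
    (hφ : IsBessel fun k : Fin d → ℤ => translation (intVec k) φ) (D : L2 d ≃ₗᵢ[ℂ] L2 d)
    (hlevel : ∀ f, HasSum (fun m => ‖(inner ℂ (translation (intVec m) ψ) f : ℂ)‖ ^ 2)
      (‖analysis hφ (D⁻¹ f)‖ ^ 2 - ‖analysis hφ f‖ ^ 2))
    (hhigh : ∀ f, Filter.Tendsto (fun n : ℕ => ‖analysis hφ ((D⁻¹ ^ n) f)‖) Filter.atTop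
      (nhds ‖f‖))
    (hlow : ∀ f, Filter.Tendsto (fun n : ℕ => ‖analysis hφ ((D ^ n) f)‖) Filter.atTop (nhds 0)) :
    IsNormalizedTightFrame fun p : ℤ × (Fin d → ℤ) => (D ^ p.1) (translation (intVec p.2) ψ) := by
  intro f
  set energy : ℤ → ℝ := fun n => ‖analysis hφ ((D ^ n)⁻¹ f)‖ ^ 2 with henergy
  have hrow (n : ℤ) : HasSum (fun m : Fin d → ℤ =>
      ‖(inner ℂ f ((D ^ n) (translation (intVec m) ψ)) : ℂ)‖ ^ 2) (energy (n + 1) - energy n) := by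
    have hstep : (D ^ (n + 1))⁻¹ f = D⁻¹ ((D ^ n)⁻¹ f) := by
      rw [zpow_add_one, mul_inv_rev]
      rfl
    simp only [henergy, hstep]
    refine (hlevel ((D ^ n)⁻¹ f)).congr_fun fun m => ?_
    rw [norm_inner_symm, (D ^ n).inner_map_eq_flip]
    rfl
  have hmono : Monotone energy :=
    monotone_int_of_le_succ fun n => sub_nonneg.mp ((hrow n).nonneg fun m => sq_nonneg _)
  have hsum : HasSum (fun n => energy (n + 1) - energy n) (‖f‖ ^ 2) := by
    have htop : Filter.Tendsto (fun n : ℕ => energy n) Filter.atTop (nhds (‖f‖ ^ 2)) := by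
      simpa only [henergy, zpow_natCast, inv_pow] using (hhigh f).pow 2
    have hbot : Filter.Tendsto (fun n : ℕ => energy (-n)) Filter.atTop (nhds (0 ^ 2)) := by
      simpa only [henergy, zpow_neg, zpow_natCast, inv_inv] using (hlow f).pow 2
    simpa using hasSum_int_sub_of_monotone hmono htop hbot
  exact hasSum_prod_of_nonneg (fun p => sq_nonneg _) hrow hsum

theorem IsFiniteLawtonSolution.isParsevalFrameWavelet {A : Matrix (Fin d) (Fin d) ℤ}
    {N : ℕ} {h : (Fin d → ℤ) → ℂ} {l q : Fin d → ℤ} (hh : IsFiniteLawtonSolution A N h)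
    (hA : A.det.natAbs = 2) (hexp : IsExpansive A)
    (hq : ∀ x, x ∈ lattice A ↔ Even (q ⬝ᵥ x)) (hl : Odd (q ⬝ᵥ l)) {φ : L2 d}
    (hφ : FT d φ =ᵐ[volume] maskProd (toReal A)ᵀ⁻¹ (mask N h)) :
    IsParsevalFrameWavelet A (wavelet A l q h φ) := by
  have hdet := det_ne_zero_of_natAbs_eq_two hA
  have hdetR := det_toReal_ne_zero hdet
  have hc := hexp.isContracting_transpose_inv hdet
  have hd : 0 < d := Nat.pos_of_ne_zero fun hd => by subst hd; simp at hA
  have hBessel := hh.isBessel_translation hA hc hφ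
  exact isNormalizedTightFrame_of_level_energy hBessel _
    (hh.hasSum_sq_norm_inner_wavelet hdet hq hl hBessel (hh.eq_refinement hA hc hφ))
    (tendsto_norm_analysis_dilation_inv hBessel hφ
      (tendsto_maskProd_nhds_zero hc hh.isBigO_mask_sub_one) hdetR hc)
    (tendsto_norm_analysis_dilation hBessel hd hdetR (hexp.isContracting_inv hdet))

/-! ### The spaces `V^{(n)}` -/

theorem mem_space {B : Matrix (Fin d) (Fin d) ℤ} {φ : L2 d} {n : ℤ} {x : L2 d} :
    x ∈ space B φ n ↔ ∃ y ∈ spaceZero φ, (dilation (toReal B) ^ n) y = x := Iff.rfl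

theorem translation_mem_spaceZero (φ : L2 d) (k : Fin d → ℤ) :
    translation (intVec k) φ ∈ spaceZero φ :=
  Submodule.le_topologicalClosure _ (Submodule.subset_span ⟨k, rfl⟩)

theorem isClosed_space (B : Matrix (Fin d) (Fin d) ℤ) (φ : L2 d) (n : ℤ) :
    IsClosed (space B φ n : Set (L2 d)) :=
  (dilation (toReal B) ^ n).toHomeomorph.isClosedMap _ (Submodule.isClosed_topologicalClosure _)

section Spaces

variable {B : Matrix (Fin d) (Fin d) ℤ} {φ : L2 d} {ι : Type*} {s : Finset ι} {c : ι → ℂ}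
  {k : ι → Fin d → ℤ}

theorem translation_mem_space_one (hdet : B.det ≠ 0) {x : L2 d}
    (hx : x = ∑ i ∈ s, c i • dilation (toReal B) (translation (intVec (k i)) φ))
    (m : Fin d → ℤ) : translation (intVec m) x ∈ space B φ 1 := by
  rw [hx, map_sum]
  refine Submodule.sum_mem _ fun i _ => ?_
  rw [map_smul, translation_dilation (det_toReal_ne_zero hdet), act_intVec, translation_add,
    ← intVec_add]
  exact Submodule.smul_mem _ _ (mem_space.mpr
    ⟨_, translation_mem_spaceZero φ (B *ᵥ m + k i), by rw [zpow_one]⟩)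

theorem zpow_apply_mem_space {x : L2 d} (hx : x ∈ space B φ 1) (n : ℤ) :
    (dilation (toReal B) ^ n) x ∈ space B φ (n + 1) := by
  obtain ⟨y, hy, rfl⟩ := mem_space.mp hx
  exact mem_space.mpr ⟨y, hy, by rw [zpow_add]; rfl⟩

theorem space_le_space_add_one (hdet : B.det ≠ 0)
    (hφ : φ = ∑ i ∈ s, c i • dilation (toReal B) (translation (intVec (k i)) φ)) (n : ℤ) :
    space B φ n ≤ space B φ (n + 1) := by
  have hzero : spaceZero φ ≤ space B φ 1 := by
    refine Submodule.topologicalClosure_minimal _ (Submodule.span_le.mpr ?_) (isClosed_space B φ 1)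
    rintro _ ⟨m, rfl⟩
    exact translation_mem_space_one hdet hφ m
  intro x hx
  obtain ⟨y, hy, rfl⟩ := mem_space.mp hx
  exact zpow_apply_mem_space (hzero hy) n

theorem closure_iUnion_space (hmono : ∀ n : ℤ, space B φ n ≤ space B φ (n + 1)) {ψ : L2 d}
    (hψ : ∀ m : Fin d → ℤ, translation (intVec m) ψ ∈ space B φ 1)
    (hframe : IsParsevalFrameWavelet B ψ) :
    closure (⋃ n : ℤ, (space B φ n : Set (L2 d))) = Set.univ := by
  have hdirected : Directed (· ≤ ·) (space B φ) := (monotone_int_of_le_succ hmono).directed_le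
  rw [← Submodule.coe_iSup_of_directed _ hdirected, ← Submodule.topologicalClosure_coe,
    ← Submodule.top_coe (R := ℂ), SetLike.coe_set_eq, Submodule.topologicalClosure_eq_top_iff,
    Submodule.eq_bot_iff]
  intro f hf
  have hcoeff (p : ℤ × (Fin d → ℤ)) :
      (inner ℂ f ((dilation (toReal B) ^ p.1) (translation (intVec p.2) ψ)) : ℂ) = 0 :=
    (Submodule.mem_orthogonal' _ f).mp hf _
      (Submodule.mem_iSup_of_mem (p.1 + 1) (zpow_apply_mem_space (hψ p.2) p.1))
  have hsum := hframe f
  simp only [hcoeff, norm_zero, zero_pow two_ne_zero] at hsum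
  exact norm_eq_zero.mp (sq_eq_zero_iff.mp (hsum.unique hasSum_zero))

end Spaces

/-! ### Change of lattice basis -/

section Pullback

variable {A₀ A S : Matrix (Fin d) (Fin d) ℤ} {l q : Fin d → ℤ} {N : ℕ} {h : (Fin d → ℤ) → ℂ}

theorem PartitionData.det_toReal_S_ne_zero (hP : PartitionData A₀ A S l q) :
    (toReal S).det ≠ 0 :=
  det_toReal_ne_zero hP.isUnit_det_S.ne_zero

theorem PartitionData.S_mul (hP : PartitionData A₀ A S l q) : S * A₀ = A * S := by
  rw [hP.similar, mul_assoc, Matrix.mul_nonsing_inv_cancel_left _ _ hP.isUnit_det_S]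

theorem PartitionData.dilation_dilation_S (hP : PartitionData A₀ A S l q) (hdet : A.det ≠ 0)
    (x : L2 d) : dilation (toReal A₀) (dilation (toReal S) x)
      = dilation (toReal S) (dilation (toReal A) x) := by
  have hdet₀ : A₀.det ≠ 0 := hP.det_eq ▸ hdet
  rw [dilation_dilation hP.det_toReal_S_ne_zero (det_toReal_ne_zero hdet), dilation_dilation
    (det_toReal_ne_zero hdet₀) hP.det_toReal_S_ne_zero, ← toReal_mul, ← toReal_mul, hP.S_mul]

theorem PartitionData.zpow_dilation_dilation_S (hP : PartitionData A₀ A S l q) (hdet : A.det ≠ 0)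
    (n : ℤ) (x : L2 d) : (dilation (toReal A₀) ^ n) (dilation (toReal S) x)
      = dilation (toReal S) ((dilation (toReal A) ^ n) x) := by
  have hsemiconj : SemiconjBy (dilation (toReal S)) (dilation (toReal A))
      (dilation (toReal A₀)) :=
    LinearIsometryEquiv.ext fun y => (hP.dilation_dilation_S hdet y).symm
  exact (congrArg (fun T : L2 d ≃ₗᵢ[ℂ] L2 d => T x) (hsemiconj.zpow_right n)).symm

theorem PartitionData.translation_dilation_S (hP : PartitionData A₀ A S l q) (m : Fin d → ℤ)
    (x : L2 d) : translation (intVec m) (dilation (toReal S) x)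
      = dilation (toReal S) (translation (intVec (S *ᵥ m)) x) := by
  rw [translation_dilation hP.det_toReal_S_ne_zero, act_intVec]

theorem PartitionData.dilation_S_dilation_translation (hP : PartitionData A₀ A S l q)
    (hdet : A.det ≠ 0) (n : Fin d → ℤ) (x : L2 d) :
    dilation (toReal S) (dilation (toReal A) (translation (intVec n) x))
      = dilation (toReal A₀) (translation (intVec (S⁻¹ *ᵥ n)) (dilation (toReal S) x)) := by
  rw [hP.translation_dilation_S, hP.dilation_dilation_S hdet, Matrix.mulVec_mulVec,
    Matrix.mul_nonsing_inv _ hP.isUnit_det_S, Matrix.one_mulVec]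

theorem PartitionData.isParsevalFrameWavelet (hP : PartitionData A₀ A S l q)
    (hdet : A.det ≠ 0) {ψ : L2 d} (hψ : IsParsevalFrameWavelet A ψ) :
    IsParsevalFrameWavelet A₀ (dilation (toReal S) ψ) := by
  intro f
  let σ : (Fin d → ℤ) ≃ (Fin d → ℤ) :=
    (Matrix.toLinearEquiv' S (S.invertibleOfIsUnitDet hP.isUnit_det_S)).toEquiv
  have hsum := hψ ((dilation (toReal S))⁻¹ f)
  rw [← ((Equiv.refl ℤ).prodCongr σ).hasSum_iff, LinearIsometryEquiv.norm_map] at hsum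
  refine hsum.congr_fun fun p => ?_
  simp only [hP.translation_dilation_S, hP.zpow_dilation_dilation_S hdet]
  rw [norm_inner_symm, inner_dilation_left, norm_inner_symm]
  rfl

theorem PartitionData.dilation_S_eq_sum (hP : PartitionData A₀ A S l q) (hdet : A.det ≠ 0)
    {φ : L2 d} (hφ : φ = refinement A N h φ) :
    dilation (toReal S) φ = ∑ n ∈ box d N, h n • dilation (toReal A₀)
      (translation (intVec (S⁻¹ *ᵥ n)) (dilation (toReal S) φ)) := by
  conv_lhs => rw [hφ]
  simp only [refinement, map_sum, map_smul, hP.dilation_S_dilation_translation hdet]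

theorem IsFiniteLawtonSolution.dilation_S_wavelet_eq_sum (hh : IsFiniteLawtonSolution A N h)
    (hP : PartitionData A₀ A S l q) (hdet : A.det ≠ 0) (φ : L2 d) :
    dilation (toReal S) (wavelet A l q h φ) = ∑ n ∈ (box d N).image (fun m => l - m),
      highPass l q h n • dilation (toReal A₀)
        (translation (intVec (S⁻¹ *ᵥ n)) (dilation (toReal S) φ)) := by
  simp only [hh.wavelet_eq, map_sum, map_smul, hP.dilation_S_dilation_translation hdet]

end Pullback

end

end ParsevalWavelet

theorem theorem9p1 {d : ℕ} (A₀ : Matrix (Fin d) (Fin d) ℤ)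
    (hexp : ParsevalWavelet.IsExpansive A₀) (hdet : A₀.det = 2 ∨ A₀.det = -2) :
    (∃ (A S : Matrix (Fin d) (Fin d) ℤ) (l q : Fin d → ℤ),
      ParsevalWavelet.PartitionData A₀ A S l q) ∧
    ∀ (A S : Matrix (Fin d) (Fin d) ℤ) (l q : Fin d → ℤ),
      ParsevalWavelet.PartitionData A₀ A S l q →
    ∀ (N₀ : ℕ) (h : (Fin d → ℤ) → ℂ), ParsevalWavelet.IsFiniteLawtonSolution A N₀ h →
      (∀ ξ : ParsevalWavelet.Euc d, Multipliable (ParsevalWavelet.factor A h ξ)) ∧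
      ∃ hg : MeasureTheory.MemLp (ParsevalWavelet.scalingFourier A h) 2
          (MeasureTheory.volume : MeasureTheory.Measure (ParsevalWavelet.Euc d)),
        ParsevalWavelet.IsParsevalFrameWavelet A₀
          (ParsevalWavelet.waveletPullback A S l q h hg) ∧
        ParsevalWavelet.scalingPullback A S h hg =
          ∑ n ∈ ParsevalWavelet.box d N₀,
            h n • ParsevalWavelet.dilation (ParsevalWavelet.toReal A₀)
              (ParsevalWavelet.translation (ParsevalWavelet.intVec (S⁻¹.mulVec n))
                (ParsevalWavelet.scalingPullback A S h hg)) ∧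
        ParsevalWavelet.waveletPullback A S l q h hg =
          ∑ n ∈ (ParsevalWavelet.box d N₀).image (fun m => l - m),
            ((-1 : ℂ) ^ (dotProduct q n) * (starRingEnd ℂ) (h (l - n))) •
              ParsevalWavelet.dilation (ParsevalWavelet.toReal A₀)
                (ParsevalWavelet.translation (ParsevalWavelet.intVec (S⁻¹.mulVec n))
                  (ParsevalWavelet.scalingPullback A S h hg)) ∧
        (∀ n : ℤ, ParsevalWavelet.space A₀ (ParsevalWavelet.scalingPullback A S h hg) n ≤
          ParsevalWavelet.space A₀ (ParsevalWavelet.scalingPullback A S h hg) (n + 1)) ∧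
        closure (⋃ n : ℤ, (ParsevalWavelet.space A₀
            (ParsevalWavelet.scalingPullback A S h hg) n : Set (ParsevalWavelet.L2 d)))
          = Set.univ := by
  have hA₀ : A₀.det.natAbs = 2 := by omega
  refine ⟨ParsevalWavelet.exists_partitionData A₀ hA₀, fun A S l q hP N h hh => ?_⟩
  have hA : A.det.natAbs = 2 := hP.det_eq ▸ hA₀
  have hdetA := ParsevalWavelet.det_ne_zero_of_natAbs_eq_two hA
  have hdetA₀ := ParsevalWavelet.det_ne_zero_of_natAbs_eq_two hA₀
  have hexpA := hP.isExpansive hexp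
  have hc := hexpA.isContracting_transpose_inv hdetA
  have hg := hh.memLp_scalingFourier hA hc
  have hφ := hh.coeFn_FT_scaling hA hc hg
  have hframe := hP.isParsevalFrameWavelet hdetA
    (hh.isParsevalFrameWavelet hA hexpA hP.mem_lattice_iff_even hP.odd_shift hφ)
  have hscaling := hP.dilation_S_eq_sum hdetA (hh.eq_refinement hA hc hφ)
  have hwavelet := hh.dilation_S_wavelet_eq_sum hP hdetA (ParsevalWavelet.scaling A h hg)
  have hmono := ParsevalWavelet.space_le_space_add_one hdetA₀ hscaling
  exact ⟨hh.multipliable_factor hc, hg, hframe, hscaling, hwavelet, hmono,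
    ParsevalWavelet.closure_iUnion_space hmono
      (ParsevalWavelet.translation_mem_space_one hdetA₀ hwavelet) hframe⟩
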